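/- Let $G=(V,E)$ be a finite undirected graph (parallel edges and loops allowed), let $T\subseteq V$ be a set of terminals, let $r\in T$ be the root, and let $k$ be a positive integer. For $X\subseteq V$ let $d_G(X)$ be the number of edges with exactly one end in $X$, and for distinct $u,v\in V$ let $\lambda_G(u,v)=\min\{d_G(X): u\in X\subseteq V\setminus\{v\}\}$. Suppose that $G$ is Steiner $2k$-edge-connected, that is, $\lambda_G(u,v)\ge 2k$ for every pair of distinct terminals $u,v\in T$. Then $G$ has a Steiner rooted $k$-arc-connected orientation: each edge of $G$ can be assigned a direction so that in the resulting directed graph, for every terminal $t\in T\setminus\{r\}$, there exist $k$ pairwise arc-disjoint directed paths from $t$ to $r$. -/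

import Mathlib

open scoped Graph

namespace Graph

universe u v

variable {α : Type u} {β : Type v}

/-- The set `δ_G(X)` of edges of the multigraph `G` with one end in `X` and the other outside `X`.
Parallel edges are counted separately and loops never cross a cut. -/
def cutEdges (G : Graph α β) (X : Set α) : Set β :=
  {e | ∃ x ∈ X, ∃ y, y ∉ X ∧ G.IsLink e x y}

/-- The cut value `d_G(X)`. -/
noncomputable def cutValue (G : Graph α β) (X : Set α) : ℕ∞ :=
  (G.cutEdges X).encard

/-- The local edge-connectivity `λ_G(s, t) = min {d_G(X) : s ∈ X ⊆ V(G) \ {t}}`. It is used only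
for distinct vertices `s` and `t` of `G`. -/
noncomputable def localConnectivity (G : Graph α β) (s t : α) : ℕ∞ :=
  ⨅ X ∈ {X : Set α | s ∈ X ∧ X ⊆ V(G) \ {t}}, G.cutValue X

/-- `λ_G(s, t) ≥ k` for every pair of distinct terminals `s, t ∈ T`. -/
def IsSteinerEdgeConnected (G : Graph α β) (T : Set α) (k : ℕ) : Prop :=
  ∀ s ∈ T, ∀ t ∈ T, s ≠ t → (k : ℕ∞) ≤ G.localConnectivity s t

/-- An orientation of the multigraph `G`: each edge becomes one arc, directed from one of its ends
(`tail`) to the other (`head`). -/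
structure Orientation (G : Graph α β) where
  /-- The vertex which the arc leaves. -/
  tail : E(G) → α
  /-- The vertex which the arc enters. -/
  head : E(G) → α
  isLink_tail_head : ∀ e : E(G), G.IsLink e (tail e) (head e)

/-- A directed path from `s` to `t` in an orientation `D` of `G`: vertices
`vert 0 = s, …, vert length = t`, all distinct, and arcs `arc i` from `vert i` to `vert (i + 1)`.
(The arcs are then distinct too, as their tails are.) -/
structure DiPath {G : Graph α β} (D : G.Orientation) (s t : α) where
  /-- The number of arcs. -/
  length : ℕ
  /-- The vertices, in order. -/
  vert : Fin (length + 1) → α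
  /-- The arcs, in order. -/
  arc : Fin length → E(G)
  vert_zero : vert 0 = s
  vert_last : vert (Fin.last length) = t
  tail_arc : ∀ i : Fin length, D.tail (arc i) = vert i.castSucc
  head_arc : ∀ i : Fin length, D.head (arc i) = vert i.succ
  vert_injective : Function.Injective vert

/-- The orientation `D` is Steiner rooted `k`-arc-connected with respect to terminals `T` and root
`r`: for every `t ∈ T \ {r}` there are `k` pairwise arc-disjoint directed paths from `t` to `r`. -/
def Orientation.IsSteinerRootedConnected {G : Graph α β} (D : G.Orientation)
    (T : Set α) (r : α) (k : ℕ) : Prop :=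
  ∀ t ∈ T \ {r}, ∃ P : Fin k → DiPath D t r,
    Pairwise fun i j => Disjoint (Set.range (P i).arc) (Set.range (P j).arc)

end Graph

/-! By the arc form of Menger's theorem it suffices to orient the edges so that at least `k` arcs
leave every set that avoids the root and meets `T`. The cut condition supplies `2 * k` edges on each
such set. A new root, joined to `r` by `2 * k` parallel edges of which half are directed each way,
reduces this to an extension problem: a balanced orientation at a root of degree `2 * k` is to be
extended to the whole graph (`exists_isExtension`). To make the induction work, `IsExtension` also
asks that `k` arcs enter every set that avoids the root and contains `T`.

The extension is found by induction on the number of edges with both ends outside `insert r T`. Such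
an edge can be deleted if no tight set (cut value `2 * k`) separates its ends. Otherwise let `X` be
a separating tight set. Contracting `X` to a terminal `x₀` and contracting its complement to the
root both destroy the edge. The first contraction is solved with exactly `k` arcs leaving `x₀`. This
is a balanced orientation at the root of the second contraction, so the second solution extends it,
and uncrossing with `X` shows that the two fit together (`IsExtension.combine`).

With no such edge left, the graph is a union of stars: each non-terminal is a center, and an edge
inside `insert r T` is subdivided by a center of its own. Half-edges are directed so that a star of
degree `d` has `d / 2` of them, rounded down, directed away from its center. If `h` is this number
at the center `c`, then the arcs leaving any set with terminal set `X` number at least the sum over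
`c` of `min (d_c X) h`, minus the in-degrees on `X`. Hence the in-degrees at terminals must lie
below an intersecting submodular function. Such a vector exists by the partition condition
(`exists_inDegree_vector`), and Hakimi's theorem realizes it (`exists_heads`). -/

namespace SteinerOrientation

open Finset

variable {V β : Type*} [DecidableEq V]

/-! ### Cut functions and their submodularity -/

/-- The number of edges of `E`, with ends `a` and `b`, that have exactly one end in `Z`. -/
def cutDeg (E : Finset β) (a b : β → V) (Z : Finset V) : ℕ :=
  #{e ∈ E | ¬(a e ∈ Z ↔ b e ∈ Z)}

/-- The number of arcs of `E`, with tails `s` and heads `t`, that leave `Z`. The number of arcs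
entering `Z` is `outDeg E t s Z`. -/
def outDeg (E : Finset β) (s t : β → V) (Z : Finset V) : ℕ :=
  #{e ∈ E | s e ∈ Z ∧ t e ∉ Z}

theorem outDeg_add_outDeg_swap (E : Finset β) (s t : β → V) (Z : Finset V) :
    outDeg E s t Z + outDeg E t s Z = cutDeg E s t Z := by
  simp only [outDeg, cutDeg, card_filter]
  rw [← sum_add_distrib]
  refine sum_congr rfl fun e _ => ?_
  by_cases h1 : s e ∈ Z <;> by_cases h2 : t e ∈ Z <;> simp [h1, h2]

theorem outDeg_inter_add_union_le (E : Finset β) (s t : β → V) (Z W : Finset V) :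
    outDeg E s t (Z ∩ W) + outDeg E s t (Z ∪ W) ≤ outDeg E s t Z + outDeg E s t W := by
  simp only [outDeg, card_filter]
  rw [← sum_add_distrib, ← sum_add_distrib]
  refine sum_le_sum fun e _ => ?_
  by_cases h1 : s e ∈ Z <;> by_cases h2 : t e ∈ Z <;> by_cases h3 : s e ∈ W <;>
    by_cases h4 : t e ∈ W <;> simp [h1, h2, h3, h4]

/-- This is submodularity for `Z` and the complement of `W`. -/
theorem outDeg_sdiff_add_swap_le (E : Finset β) (s t : β → V) (Z W : Finset V) :
    outDeg E s t (Z \ W) + outDeg E t s (W \ Z) ≤ outDeg E s t Z + outDeg E t s W := by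
  simp only [outDeg, card_filter]
  rw [← sum_add_distrib, ← sum_add_distrib]
  refine sum_le_sum fun e _ => ?_
  by_cases h1 : s e ∈ Z <;> by_cases h2 : t e ∈ Z <;> by_cases h3 : s e ∈ W <;>
    by_cases h4 : t e ∈ W <;> simp [h1, h2, h3, h4]

theorem outDeg_mono {E F : Finset β} (h : F ⊆ E) (s t : β → V) (Z : Finset V) :
    outDeg F s t Z ≤ outDeg E s t Z :=
  card_le_card (filter_subset_filter _ h)

theorem outDeg_compl [Fintype V] (E : Finset β) (s t : β → V) (Z : Finset V) :
    outDeg E s t Zᶜ = outDeg E t s Z := by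
  simp only [outDeg, mem_compl, not_not]
  congr 1; ext e; simp [and_comm]

theorem outDeg_sub_swap_eq_sum (E : Finset β) (s t : β → V) (Z : Finset V) :
    (outDeg E s t Z : ℤ) - outDeg E t s Z = ∑ v ∈ Z, ((outDeg E s t {v} : ℤ) - outDeg E t s {v}) := by
  simp only [outDeg, card_filter, Nat.cast_sum, ← sum_sub_distrib]
  rw [sum_comm]
  refine sum_congr rfl fun e _ => ?_
  have key : ∀ v, (((if s e ∈ ({v} : Finset V) ∧ t e ∉ ({v} : Finset V) then 1 else 0 : ℕ) : ℤ) -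
      ((if t e ∈ ({v} : Finset V) ∧ s e ∉ ({v} : Finset V) then 1 else 0 : ℕ) : ℤ)) =
      (if s e = v then 1 else 0) - (if t e = v then 1 else 0) := by
    intro v
    by_cases h1 : s e = v <;> by_cases h2 : t e = v <;> simp [h1, h2]
  simp only [key, sum_sub_distrib, sum_ite_eq]
  by_cases h1 : s e ∈ Z <;> by_cases h2 : t e ∈ Z <;> simp [h1, h2]

/-! ### Uncrossing tight sets, and Menger's theorem -/

/-- If the arcs leaving `v` to vertices other than `r` all leave tight sets, then they all leave a
common tight set. -/
theorem exists_tight_of_forall_arc {E : Finset β} {s t : β → V} {k : ℕ} {p : Finset V → Prop}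
    {v : V} (hp : ∀ Z W, p Z → p W → v ∈ Z → v ∈ W → p (Z ∩ W) ∧ p (Z ∪ W))
    (hk : ∀ Z, p Z → k ≤ outDeg E s t Z) {q : β → Prop} (hq : ∃ e ∈ E, s e = v ∧ q e)
    (h : ∀ e ∈ E, s e = v → q e → ∃ Z, p Z ∧ v ∈ Z ∧ t e ∉ Z ∧ outDeg E s t Z = k) :
    ∃ Z, p Z ∧ v ∈ Z ∧ outDeg E s t Z = k ∧ ∀ e ∈ E, s e = v → q e → t e ∉ Z := by
  classical
  have hex : ∃ n, ∃ Z : Finset V, p Z ∧ v ∈ Z ∧ outDeg E s t Z = k ∧ #Z = n := by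
    obtain ⟨e, he, hs, hqe⟩ := hq
    obtain ⟨Z, h1, h2, -, h3⟩ := h e he hs hqe
    exact ⟨_, Z, h1, h2, h3, rfl⟩
  obtain ⟨Z, h1, h2, h3, h4⟩ := Nat.find_spec hex
  refine ⟨Z, h1, h2, h3, fun e he hs hqe hte => ?_⟩
  obtain ⟨W, w1, w2, w3, w4⟩ := h e he hs hqe
  have hZW := hp Z W h1 w1 h2 w2
  have hsub := outDeg_inter_add_union_le E s t Z W
  have hi := hk _ hZW.1
  have hu := hk _ hZW.2
  -- By submodularity `Z ∩ W` is tight again. It is smaller than the minimum-size set `Z`, because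
  -- it misses the head of `e`.
  refine Nat.find_min hex (m := #(Z ∩ W)) ?_ ⟨Z ∩ W, hZW.1, by simp [h2, w2], by omega, rfl⟩
  rw [← h4]
  refine card_lt_card ⟨inter_subset_left, fun hh => w3 (mem_inter.1 (hh hte)).2⟩

/-- `IsDipath s t r x p`: the list `p` of arcs is a directed path from `x` to `r`. -/
inductive IsDipath (s t : β → V) (r : V) : V → List β → Prop
  | nil : IsDipath s t r r []
  | cons (e : β) (p : List β) : IsDipath s t r (t e) p → s e ≠ r → s e ∉ p.map s →
      IsDipath s t r (s e) (e :: p)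

theorem IsDipath.exists_suffix {s t : β → V} {r x y : V} {p : List β} (h : IsDipath s t r x p)
    (hy : y ∈ p.map s) : ∃ q, q ⊆ p ∧ IsDipath s t r y q := by
  induction h with
  | nil => simp at hy
  | cons e p h h1 h2 ih =>
    by_cases hye : y = s e
    · subst hye; exact ⟨_, fun _ h => h, .cons e p h h1 h2⟩
    · obtain ⟨q, hq, hq'⟩ := ih (by simpa [hye] using hy)
      exact ⟨q, fun z hz => List.mem_cons_of_mem _ (hq hz), hq'⟩

theorem exists_isDipath [Fintype V] {E : Finset β} {s t : β → V} {r x : V}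
    (h : ∀ Z, x ∈ Z → r ∉ Z → 0 < outDeg E s t Z) :
    ∃ p : List β, (∀ e ∈ p, e ∈ E) ∧ IsDipath s t r x p := by
  classical
  by_contra hx
  -- No arc of `E` leaves the set of vertices from which `r` cannot be reached.
  let Z : Finset V := {v | ¬ ∃ p : List β, (∀ e ∈ p, e ∈ E) ∧ IsDipath s t r v p}
  have hZ := h Z (by simpa [Z] using hx) (by
    simp only [Z, mem_filter, mem_univ, true_and, not_not]
    exact ⟨[], by simp, .nil⟩)
  obtain ⟨e, he⟩ := card_pos.1 hZ
  simp only [Z, mem_filter, mem_univ, true_and, not_not] at he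
  obtain ⟨heE, hs, p, hp, hpath⟩ := he
  refine hs ?_
  by_cases h1 : s e = r
  · exact ⟨[], by simp, h1 ▸ .nil⟩
  by_cases h2 : s e ∈ p.map s
  · obtain ⟨q, hq, hq'⟩ := hpath.exists_suffix h2
    exact ⟨q, fun e he => hp e (hq he), hq'⟩
  · exact ⟨e :: p, by simpa [heE] using hp, .cons e p hpath h1 h2⟩

theorem IsDipath.outDeg_toFinset [DecidableEq β] {s t : β → V} {r x : V} {p : List β}
    (h : IsDipath s t r x p) (Z : Finset V) :
    (outDeg p.toFinset s t Z : ℤ) - outDeg p.toFinset t s Z =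
      (if x ∈ Z then 1 else 0) - (if r ∈ Z then 1 else 0) := by
  induction h with
  | nil => simp [outDeg]
  | cons e p h h1 h2 ih =>
    have he : e ∉ p.toFinset := fun he => h2 (List.mem_map_of_mem (List.mem_toFinset.1 he))
    rw [List.toFinset_cons]
    simp only [outDeg, card_filter, sum_insert he, Nat.cast_add] at ih ⊢
    by_cases h3 : s e ∈ Z <;> by_cases h4 : t e ∈ Z <;> simp [h3, h4] at ih ⊢ <;> linarith

theorem outDeg_sdiff_add [DecidableEq β] {E P : Finset β} (h : P ⊆ E) (s t : β → V)
    (Z : Finset V) : outDeg (E \ P) s t Z + outDeg P s t Z = outDeg E s t Z := by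
  simp only [outDeg, card_filter]
  exact sum_sdiff h

/-- In a minimal arc set with `k` arcs leaving every set separating `x` from `r`, no vertex other
than `x` has more leaving than entering arcs. -/
theorem outDeg_singleton_le_of_minimal [Fintype V] [DecidableEq β] {E : Finset β} {s t : β → V}
    {r x : V} {k : ℕ} (h : ∀ Z, x ∈ Z → r ∉ Z → k ≤ outDeg E s t Z)
    (hmin : ∀ e ∈ E, ∃ Z, x ∈ Z ∧ r ∉ Z ∧ outDeg (E.erase e) s t Z < k) {v : V} (hv : v ≠ x) :
    outDeg E s t {v} ≤ outDeg E t s {v} := by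
  have hcross : ∀ e ∈ E, ∃ Z, (x ∈ Z ∧ r ∉ Z) ∧ s e ∈ Z ∧ t e ∉ Z ∧ outDeg E s t Z = k := by
    intro e he
    obtain ⟨Z, h1, h2, h3⟩ := hmin e he
    have h4 := h Z h1 h2
    have h5 : outDeg {e} s t Z ≤ 1 := (card_filter_le _ _).trans (by simp)
    have h6 := outDeg_sdiff_add (singleton_subset_iff.2 he) s t Z
    rw [← erase_eq] at h6
    have h7 : 0 < outDeg {e} s t Z := by omega
    obtain ⟨e', h8⟩ := card_pos.1 h7
    obtain ⟨h9, h10, h11⟩ := mem_filter.1 h8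
    rw [mem_singleton.1 h9] at h10 h11
    exact ⟨Z, ⟨h1, h2⟩, h10, h11, by omega⟩
  by_cases hq : ∃ e ∈ E, s e = v ∧ True
  · obtain ⟨Z, ⟨h1, h1'⟩, h2, h3, h4⟩ := exists_tight_of_forall_arc (E := E) (s := s) (t := t)
      (k := k) (p := fun Z => x ∈ Z ∧ r ∉ Z) (v := v) (q := fun _ => True)
      (by
        rintro Z W ⟨h1, h2⟩ ⟨h3, h4⟩ - -
        simp [h1, h2, h3, h4]) (fun Z hZ => h Z hZ.1 hZ.2) hq
      (by
        rintro e he rfl -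
        exact hcross e he)
    -- Removing `v` from the tight set `Z` loses all arcs leaving `v` and gains at most those
    -- entering `v`; the value must not drop below `k`.
    have h5 := h (Z.erase v) (mem_erase.2 ⟨hv.symm, h1⟩) (fun hr => h1' (mem_of_mem_erase hr))
    have h6 : outDeg E s t (Z.erase v) + outDeg E s t {v} ≤
        outDeg E s t Z + outDeg E t s {v} := by
      simp only [outDeg, card_filter]
      rw [← sum_add_distrib, ← sum_add_distrib]
      refine sum_le_sum fun e he => ?_
      have h7 := h4 e he
      by_cases c1 : s e = v <;> by_cases c2 : t e = v <;> by_cases c3 : s e ∈ Z <;>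
        by_cases c4 : t e ∈ Z <;> simp_all
    omega
  · have : outDeg E s t {v} = 0 := by
      rw [outDeg, card_eq_zero, filter_eq_empty_iff]
      rintro e he ⟨h1, -⟩
      exact hq ⟨e, he, mem_singleton.1 h1, trivial⟩
    omega

/-- In a minimal arc set every vertex other than `x` has at least as many entering as leaving arcs,
and `r` has at least `k + 1` entering and none leaving. So leaving minus entering arcs is at least
`k + 1` on every set separating `x` from `r`. A path from `x` to `r` lowers this difference by
exactly one, so any path may be removed. -/
theorem exists_isDipath_forall_le_outDeg_sdiff [Fintype V] [DecidableEq β] {E : Finset β}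
    {s t : β → V} {r x : V} {k : ℕ} (hxr : x ≠ r)
    (h : ∀ Z, x ∈ Z → r ∉ Z → k + 1 ≤ outDeg E s t Z) :
    ∃ p : List β, (∀ e ∈ p, e ∈ E) ∧ IsDipath s t r x p ∧
      ∀ Z, x ∈ Z → r ∉ Z → k ≤ outDeg (E \ p.toFinset) s t Z := by
  induction E using Finset.strongInduction with
  | H E ih =>
  by_cases hmin : ∀ e ∈ E, ∃ Z, x ∈ Z ∧ r ∉ Z ∧ outDeg (E.erase e) s t Z < k + 1
  · obtain ⟨p, hp, hpath⟩ := exists_isDipath (E := E) (s := s) (t := t) (r := r) (x := x)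
      (fun Z h1 h2 => by have := h Z h1 h2; omega)
    refine ⟨p, hp, hpath, fun Z h1 h2 => ?_⟩
    have hsub : p.toFinset ⊆ E := fun e he => hp e (List.mem_toFinset.1 he)
    have e1 := outDeg_sdiff_add hsub s t Z
    have e2 := outDeg_sdiff_add hsub t s Z
    have e3 := hpath.outDeg_toFinset Z
    rw [if_pos h1, if_neg h2] at e3
    have e4 := outDeg_sub_swap_eq_sum E t s Zᶜ
    rw [outDeg_compl, outDeg_compl, ← add_sum_erase _ _ (mem_compl.2 h2)] at e4
    have e5 : 0 ≤ ∑ v ∈ Zᶜ.erase r, ((outDeg E t s {v} : ℤ) - outDeg E s t {v}) := by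
      refine sum_nonneg fun v hv => ?_
      have hvx : v ≠ x := by
        rintro rfl
        exact (mem_compl.1 (mem_of_mem_erase hv)) h1
      have := outDeg_singleton_le_of_minimal h hmin hvx
      omega
    have e6 : outDeg E s t {r} = 0 := by
      rw [outDeg, card_eq_zero, filter_eq_empty_iff]
      rintro e he ⟨h3, h4⟩
      obtain ⟨W, w1, w2, w3⟩ := hmin e he
      have w4 := h W w1 w2
      have w5 : outDeg {e} s t W = 0 := by
        rw [outDeg, card_eq_zero, filter_eq_empty_iff]
        rintro e' he' ⟨h5, -⟩
        rw [mem_singleton.1 he', mem_singleton.1 h3] at h5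
        exact w2 h5
      have w6 := outDeg_sdiff_add (singleton_subset_iff.2 he) s t W
      rw [← erase_eq] at w6
      omega
    have e7 := h {r}ᶜ (by simpa using hxr) (by simp)
    rw [outDeg_compl] at e7
    omega
  · push Not at hmin
    obtain ⟨e, he, hmin⟩ := hmin
    obtain ⟨p, hp, hpath, hc⟩ := ih _ (erase_ssubset he) hmin
    exact ⟨p, fun e' h' => mem_of_mem_erase (hp e' h'), hpath, fun Z h1 h2 =>
      (hc Z h1 h2).trans (outDeg_mono (sdiff_subset_sdiff (erase_subset _ _) subset_rfl) _ _ _)⟩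

/-- The arc version of Menger's theorem. -/
theorem exists_arcDisjoint_dipaths [Fintype V] [DecidableEq β] {E : Finset β} {s t : β → V}
    {r x : V} (hxr : x ≠ r) {k : ℕ} (h : ∀ Z, x ∈ Z → r ∉ Z → k ≤ outDeg E s t Z) :
    ∃ P : Fin k → List β, (∀ i, (∀ e ∈ P i, e ∈ E) ∧ IsDipath s t r x (P i)) ∧
      Pairwise fun i j => List.Disjoint (P i) (P j) := by
  induction k generalizing E with
  | zero => exact ⟨fun i => i.elim0, fun i => i.elim0, fun i => i.elim0⟩
  | succ k ih =>
    obtain ⟨p, hp, hpath, hc⟩ := exists_isDipath_forall_le_outDeg_sdiff hxr h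
    obtain ⟨P, hP, hdisj⟩ := ih hc
    have hpP : ∀ i, List.Disjoint p (P i) := fun i e h1 h2 =>
      (mem_sdiff.1 ((hP i).1 e h2)).2 (List.mem_toFinset.2 h1)
    refine ⟨Fin.cons p P, fun i => ?_, fun i j => ?_⟩
    · refine Fin.cases ?_ (fun i => ?_) i
      · exact ⟨hp, hpath⟩
      · exact ⟨fun e he => (mem_sdiff.1 ((hP i).1 e he)).1, (hP i).2⟩
    · refine Fin.cases ?_ (fun i => ?_) i <;> refine Fin.cases ?_ (fun j => ?_) j
      · intro h; exact absurd rfl h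
      · intro _; exact hpP j
      · intro _; exact (hpP i).symm
      · intro hij; exact hdisj fun h => hij (congrArg Fin.succ h)

/-! ### Vectors below submodular functions, and bounded in-degrees -/

/-- A bounded version of a maximal vector of an intersecting submodular polyhedron: if every
partition of `T` has `b`-value at least `b T`, then some vector bounded by `b` on the nonempty
subsets of `T` has total `b T`. -/
theorem exists_vector_le_of_intersecting_submodular {V : Type*} [DecidableEq V] {T : Finset V}
    (hT : T.Nonempty) {b : Finset V → ℤ}
    (hb : ∀ X ⊆ T, ∀ Y ⊆ T, (X ∩ Y).Nonempty → b (X ∩ Y) + b (X ∪ Y) ≤ b X + b Y)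
    (hpart : ∀ P : Finset (Finset V), (P : Set (Finset V)).PairwiseDisjoint id →
      (∀ X ∈ P, X.Nonempty) → P.biUnion id = T → b T ≤ ∑ X ∈ P, b X) :
    ∃ m : V → ℤ, ∑ v ∈ T, m v = b T ∧ ∀ X ⊆ T, X.Nonempty → ∑ v ∈ X, m v ≤ b X := by
  -- Induction on the deficit `b T - ∑ v ∈ T, m v`: `m` is raised by one at an element that lies in
  -- no tight set.
  have step : ∀ n : ℕ, ∀ m : V → ℤ, (∀ X ⊆ T, X.Nonempty → ∑ v ∈ X, m v ≤ b X) →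
      b T - ∑ v ∈ T, m v = n →
      ∃ m : V → ℤ, ∑ v ∈ T, m v = b T ∧ ∀ X ⊆ T, X.Nonempty → ∑ v ∈ X, m v ≤ b X := by
    intro n
    induction n with
    | zero => intro m hm h; exact ⟨m, by push_cast at h; linarith, hm⟩
    | succ n ih =>
      intro m hm h
      by_cases htight : ∀ v ∈ T, ∃ X ⊆ T, v ∈ X ∧ ∑ v ∈ X, m v = b X
      · exfalso
        -- Intersecting tight sets have a tight union. If tight sets cover `T`, the maximal ones
        -- therefore partition `T`, and `hpart` leaves no deficit.
        have hmax : ∀ v ∈ T, ∃ X ⊆ T, v ∈ X ∧ ∑ v ∈ X, m v = b X ∧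
            ∀ Y ⊆ T, (X ∩ Y).Nonempty → ∑ v ∈ Y, m v = b Y → Y ⊆ X := by
          intro v hv
          have hne : (T.powerset.filter fun X => v ∈ X ∧ ∑ v ∈ X, m v = b X).Nonempty := by
            obtain ⟨X, h1, h2, h3⟩ := htight v hv
            exact ⟨X, by simp [h1, h2, h3]⟩
          obtain ⟨X, hX, hXmax⟩ := exists_max_image _ card hne
          simp only [mem_filter, mem_powerset] at hX hXmax
          refine ⟨X, hX.1, hX.2.1, hX.2.2, fun Y hY hXY hYt => ?_⟩
          have h1 := hb X hX.1 Y hY hXY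
          have h2 := hm (X ∩ Y) (inter_subset_left.trans hX.1) hXY
          have h3 := hm (X ∪ Y) (union_subset hX.1 hY) ⟨v, mem_union_left _ hX.2.1⟩
          have h4 := sum_union_inter (s₁ := X) (s₂ := Y) (f := m)
          have h5 := hXmax (X ∪ Y) ⟨union_subset hX.1 hY, mem_union_left _ hX.2.1, by
            have := hX.2.2
            linarith⟩
          have h6 := eq_of_subset_of_card_le (subset_union_left (s₁ := X) (s₂ := Y)) h5
          rw [h6]; exact subset_union_right
        choose! U hU1 hU2 hU3 hU4 using hmax
        have hdisj : ((T.image U : Finset (Finset V)) : Set (Finset V)).PairwiseDisjoint id := by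
          intro X hX Y hY hXY
          obtain ⟨v, hv, rfl⟩ := mem_image.1 (mem_coe.1 hX)
          obtain ⟨w, hw, rfl⟩ := mem_image.1 (mem_coe.1 hY)
          by_contra hnd
          have hne := not_disjoint_iff_nonempty_inter.1 hnd
          simp only [id] at hne
          exact hXY (subset_antisymm
            (hU4 w hw _ (hU1 v hv) (by rwa [inter_comm]) (hU3 v hv))
            (hU4 v hv _ (hU1 w hw) hne (hU3 w hw)))
        have hun : (T.image U).biUnion id = T := by
          ext v
          simp only [mem_biUnion, mem_image, id]
          constructor
          · rintro ⟨_, ⟨w, hw, rfl⟩, hv⟩; exact hU1 w hw hv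
          · exact fun hv => ⟨_, ⟨v, hv, rfl⟩, hU2 v hv⟩
        have h1 := hpart _ hdisj (by
          intro X hX
          obtain ⟨v, hv, rfl⟩ := mem_image.1 hX
          exact ⟨v, hU2 v hv⟩) hun
        have h2 : ∑ X ∈ T.image U, b X = ∑ v ∈ T, m v := by
          conv_rhs => rw [← hun, sum_biUnion hdisj]
          refine sum_congr rfl fun X hX => ?_
          obtain ⟨v, hv, rfl⟩ := mem_image.1 hX
          exact (hU3 v hv).symm
        push_cast at h
        linarith
      · push Not at htight
        obtain ⟨v, hv, hvt⟩ := htight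
        have hsum : ∀ X : Finset V, ∑ w ∈ X, (m w + if w = v then 1 else 0) =
            ∑ w ∈ X, m w + if v ∈ X then 1 else 0 := by
          intro X; rw [sum_add_distrib, sum_ite_eq']
        refine ih (fun w => m w + if w = v then 1 else 0) ?_ ?_
        · intro X hX hXne
          rw [hsum]
          have h1 := hm X hX hXne
          split_ifs with hvX
          · have := lt_of_le_of_ne h1 (hvt X hX hvX)
            omega
          · simpa using h1
        · rw [hsum, if_pos hv]; push_cast at h; linarith
  -- The constant vector `-M` lies below `b` on nonempty sets, so it can start the induction.
  let M : ℤ := ∑ X ∈ T.powerset, |b X|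
  have hM : ∀ X ⊆ T, |b X| ≤ M := fun X hX =>
    single_le_sum (f := fun X => |b X|) (fun _ _ => abs_nonneg _) (mem_powerset.2 hX)
  have h0 : ∀ X ⊆ T, X.Nonempty → ∑ v ∈ X, (fun _ => -M) v ≤ b X := by
    intro X hX hne
    have h1 := hM X hX
    have h2 : (1 : ℤ) ≤ #X := by exact_mod_cast hne.card_pos
    have h3 := neg_abs_le (b X)
    have h4 := abs_nonneg (b X)
    simp only [sum_const, nsmul_eq_mul]
    nlinarith
  refine step (b T - ∑ v ∈ T, (fun _ => -M) v).toNat _ h0 ?_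
  rw [Int.toNat_of_nonneg]
  have := h0 T subset_rfl hT
  linarith

/-- Hakimi's theorem: edges with ends `p` and `q` can be oriented with in-degrees at most `μ` if
no vertex set `W` induces more than `μ(W)` of them. -/
theorem exists_orientation_inDegree_le {η Ω : Type*} [DecidableEq Ω] (H : Finset η)
    (p q : η → Ω) (μ : Ω → ℕ)
    (h : ∀ W : Finset Ω, #{x ∈ H | p x ∈ W ∧ q x ∈ W} ≤ ∑ w ∈ W, μ w) :
    ∃ F : η → Bool, ∀ w, #{x ∈ H | (bif F x then p x else q x) = w} ≤ μ w := by
  classical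
  -- Hall's theorem: each edge is matched to one of the `μ w` slots at one of its ends `w`, which
  -- becomes its head.
  let sl : H → Finset (Σ _ : Ω, ℕ) := fun x => ({p x.1, q x.1} : Finset Ω).sigma fun w => range (μ w)
  obtain ⟨f, hf, hfm⟩ := (Finset.all_card_le_biUnion_card_iff_exists_injective sl).1 (by
    intro A
    let W : Finset Ω := A.biUnion fun x => {p x.1, q x.1}
    have h1 : A.biUnion sl = W.sigma fun w => range (μ w) := by
      ext ⟨w, i⟩
      simp only [sl, W, mem_biUnion, mem_sigma]
      tauto
    rw [h1, card_sigma]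
    simp only [card_range]
    refine le_trans ?_ (h W)
    rw [← card_map (Function.Embedding.subtype _)]
    refine card_le_card fun x hx => ?_
    obtain ⟨y, hy, rfl⟩ := mem_map.1 hx
    refine mem_filter.2 ⟨y.2, ?_, ?_⟩ <;> refine mem_biUnion.2 ⟨y, hy, ?_⟩ <;> simp)
  have hfm' : ∀ x : H, ((f x).1 = p x.1 ∨ (f x).1 = q x.1) ∧ (f x).2 < μ (f x).1 := by
    intro x
    have := hfm x
    simpa [sl] using this
  refine ⟨fun x => if hx : x ∈ H then decide ((f ⟨x, hx⟩).1 = p x) else true, fun w => ?_⟩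
  have hhead : ∀ x : H, (bif (if hx : x.1 ∈ H then decide ((f ⟨x.1, hx⟩).1 = p x.1) else true)
      then p x.1 else q x.1) = (f x).1 := by
    rintro ⟨x, hx⟩
    simp only [hx, dite_true]
    by_cases h1 : (f ⟨x, hx⟩).1 = p x
    · simp [h1]
    · simp only [h1, decide_false, cond_false]
      exact ((hfm' ⟨x, hx⟩).1.resolve_left h1).symm
  have : #{x ∈ H | (bif (if hx : x ∈ H then decide ((f ⟨x, hx⟩).1 = p x) else true)
      then p x else q x) = w} ≤ #(range (μ w)) := by
    refine card_le_card_of_injOn (fun x => if hx : x ∈ H then (f ⟨x, hx⟩).2 else 0) ?_ ?_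
    · intro x hx
      obtain ⟨hxH, hxw⟩ := mem_filter.1 (mem_coe.1 hx)
      rw [hhead ⟨x, hxH⟩] at hxw
      simp only [hxH, dite_true, coe_range, Set.mem_Iio]
      rw [← hxw]; exact (hfm' _).2
    · intro x hx y hy hxy
      obtain ⟨hxH, hxw⟩ := mem_filter.1 (mem_coe.1 hx)
      obtain ⟨hyH, hyw⟩ := mem_filter.1 (mem_coe.1 hy)
      rw [hhead ⟨x, hxH⟩] at hxw
      rw [hhead ⟨y, hyH⟩] at hyw
      simp only [hxH, hyH, dite_true] at hxy
      have := hf (a₁ := ⟨x, hxH⟩) (a₂ := ⟨y, hyH⟩) (Sigma.ext (hxw.trans hyw.symm) (heq_of_eq hxy))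
      exact congrArg Subtype.val this
  simpa using this

/-! ### Directing the half-edges of a union of stars -/

section Stars

variable {V C η : Type*} [DecidableEq V] [DecidableEq C]

/-- The number of half-edges of `H` between the center `c` and `X`, where the half-edge `x` joins
its center `ctr x` to `t x`. -/
def starDeg (H : Finset η) (ctr : η → C) (t : η → V) (c : C) (X : Finset V) : ℕ :=
  #{x ∈ H | ctr x = c ∧ t x ∈ X}

theorem starDeg_union_add_inter (H : Finset η) (ctr : η → C) (t : η → V) (c : C)
    (X Y : Finset V) : starDeg H ctr t c (X ∪ Y) + starDeg H ctr t c (X ∩ Y) =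
      starDeg H ctr t c X + starDeg H ctr t c Y := by
  simp only [starDeg, card_filter, ← sum_add_distrib]
  refine sum_congr rfl fun x _ => ?_
  by_cases h1 : t x ∈ X <;> by_cases h2 : t x ∈ Y <;> by_cases h3 : ctr x = c <;> simp [h1, h2, h3]

theorem starDeg_mono (H : Finset η) (ctr : η → C) (t : η → V) (c : C) {X Y : Finset V}
    (h : X ⊆ Y) : starDeg H ctr t c X ≤ starDeg H ctr t c Y :=
  card_le_card fun x hx => by
    obtain ⟨h1, h2, h3⟩ := mem_filter.1 hx
    exact mem_filter.2 ⟨h1, h2, h h3⟩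

theorem starDeg_biUnion (H : Finset η) (ctr : η → C) (t : η → V) (c : C)
    {P : Finset (Finset V)} (hP : (P : Set (Finset V)).PairwiseDisjoint id) :
    starDeg H ctr t c (P.biUnion id) = ∑ X ∈ P, starDeg H ctr t c X := by
  classical
  have : {x ∈ H | ctr x = c ∧ t x ∈ P.biUnion id} = P.biUnion fun X => {x ∈ H | ctr x = c ∧ t x ∈ X} := by
    ext x
    simp only [mem_filter, mem_biUnion, id]
    tauto
  rw [starDeg, this, card_biUnion]
  · rfl
  · intro X hX Y hY hXY
    refine disjoint_left.2 fun x h1 h2 => ?_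
    exact disjoint_left.1 (hP hX hY hXY) (mem_filter.1 h1).2.2 (mem_filter.1 h2).2.2

theorem card_filter_eq_sum_center [Fintype C] (H : Finset η) (ctr : η → C) (p : η → Prop)
    [DecidablePred p] : #{x ∈ H | p x} = ∑ c, #{x ∈ H | ctr x = c ∧ p x} := by
  rw [card_eq_sum_card_fiberwise (f := ctr) (t := univ) (fun _ _ => by simp)]
  refine sum_congr rfl fun c _ => ?_
  rw [filter_filter]
  congr 1; ext x; simp [and_comm]

theorem card_filter_mem_eq_sum (H : Finset η) (t : η → V) (X : Finset V) (p : η → Prop)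
    [DecidablePred p] : #{x ∈ H | t x ∈ X ∧ p x} = ∑ v ∈ X, #{x ∈ H | t x = v ∧ p x} := by
  rw [card_eq_sum_card_fiberwise (f := t) (t := X) (fun x hx => by
    exact (mem_filter.1 (mem_coe.1 hx)).2.1)]
  refine sum_congr rfl fun c hc => ?_
  rw [filter_filter]
  congr 1; ext x; simp only [mem_filter]
  constructor
  · rintro ⟨h1, ⟨-, h2⟩, h3⟩; exact ⟨h1, h3, h2⟩
  · rintro ⟨h1, rfl, h3⟩; exact ⟨h1, ⟨hc, h3⟩, rfl⟩

/-- At most one `x j` exceeds `d / 2`, so at most one minimum on the right is truncated. In that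
case `d - x j` equals `ρ` plus the other terms. -/
theorem two_mul_half_add_sum_min_le {ι : Type*} [DecidableEq ι] (P : Finset ι) (x : ι → ℕ)
    {d ρ : ℕ} (h : ∑ i ∈ P, x i + ρ = d) :
    2 * (d / 2) + ∑ i ∈ P, min (x i) (d - x i) ≤ ρ + 2 * ∑ i ∈ P, min (x i) (d / 2) := by
  by_cases hj : ∃ j ∈ P, d / 2 < x j
  · obtain ⟨j, hj, hlt⟩ := hj
    rw [← add_sum_erase _ _ hj] at h ⊢
    rw [← add_sum_erase P (fun i => min (x i) (d / 2)) hj]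
    have h1 : ∑ i ∈ P.erase j, min (x i) (d - x i) ≤ ∑ i ∈ P.erase j, x i :=
      sum_le_sum fun i _ => min_le_left _ _
    have h2 : ∑ i ∈ P.erase j, min (x i) (d / 2) = ∑ i ∈ P.erase j, x i := by
      refine sum_congr rfl fun i hi => min_eq_left ?_
      have := single_le_sum (f := x) (fun _ _ => Nat.zero_le _) hi
      omega
    rw [h2]
    omega
  · push Not at hj
    have h1 : ∑ i ∈ P, min (x i) (d - x i) ≤ ∑ i ∈ P, x i :=
      sum_le_sum fun i _ => min_le_left _ _
    have h2 : ∑ i ∈ P, min (x i) (d / 2) = ∑ i ∈ P, x i :=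
      sum_congr rfl fun i hi => min_eq_left (hj i hi)
    rw [h2]
    omega

variable {H : Finset η} {ctr : η → C} {t : η → V} {r : V} {T : Finset V} {k : ℕ}

theorem starDeg_insert (hr : r ∉ T) (c : C) :
    starDeg H ctr t c (insert r T) = starDeg H ctr t c {r} + starDeg H ctr t c T := by
  have := starDeg_union_add_inter H ctr t c {r} T
  rw [singleton_inter_of_notMem hr, ← insert_eq] at this
  have h0 : starDeg H ctr t c ∅ = 0 := by simp [starDeg]
  omega

variable [Fintype C]

/-- The terminals can be given in-degrees that leave enough of every star outside. -/
theorem exists_inDegree_vector (hr : r ∉ T) (hT : T.Nonempty)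
    (h1 : ∀ X ⊆ T, X.Nonempty → 2 * k ≤
      ∑ c, min (starDeg H ctr t c X) (starDeg H ctr t c (insert r T) - starDeg H ctr t c X))
    (h2 : ∀ c, 2 * starDeg H ctr t c {r} ≤ starDeg H ctr t c (insert r T))
    (h3 : ∑ c, starDeg H ctr t c {r} = 2 * k) :
    ∃ m : V → ℤ, ∑ v ∈ T, m v = ∑ c, ((starDeg H ctr t c (insert r T) / 2 : ℕ) : ℤ) - k ∧
      ∀ X ⊆ T, X.Nonempty → ∑ v ∈ X, m v ≤
        ∑ c, ((min (starDeg H ctr t c X) (starDeg H ctr t c (insert r T) / 2) : ℕ) : ℤ) - k := by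
  have hbT : ∑ c, ((min (starDeg H ctr t c T) (starDeg H ctr t c (insert r T) / 2) : ℕ) : ℤ) - k =
      ∑ c, ((starDeg H ctr t c (insert r T) / 2 : ℕ) : ℤ) - k := by
    congr 1
    refine sum_congr rfl fun c _ => ?_
    have := h2 c
    have := starDeg_insert (H := H) (ctr := ctr) (t := t) hr c
    congr 1
    omega
  rw [← hbT]
  refine exists_vector_le_of_intersecting_submodular (b := fun X =>
    ∑ c, ((min (starDeg H ctr t c X) (starDeg H ctr t c (insert r T) / 2) : ℕ) : ℤ) - k) hT ?_ ?_
  · intro X _ Y _ _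
    have : ∑ c, ((min (starDeg H ctr t c (X ∩ Y)) (starDeg H ctr t c (insert r T) / 2) : ℕ) : ℤ) +
        ∑ c, ((min (starDeg H ctr t c (X ∪ Y)) (starDeg H ctr t c (insert r T) / 2) : ℕ) : ℤ) ≤
        ∑ c, ((min (starDeg H ctr t c X) (starDeg H ctr t c (insert r T) / 2) : ℕ) : ℤ) +
        ∑ c, ((min (starDeg H ctr t c Y) (starDeg H ctr t c (insert r T) / 2) : ℕ) : ℤ) := by
      rw [← sum_add_distrib, ← sum_add_distrib]
      refine sum_le_sum fun c _ => ?_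
      have e1 := starDeg_union_add_inter H ctr t c X Y
      have e2 := starDeg_mono H ctr t c (inter_subset_left (s₁ := X) (s₂ := Y))
      have e3 := starDeg_mono H ctr t c (inter_subset_right (s₁ := X) (s₂ := Y))
      omega
    linarith
  · intro P hdisj hne hun
    simp only [hbT]
    -- Summed over all stars, the root terms contribute `2 * k` and each part of `P` has cut value
    -- at least `2 * k`. Halving gives the partition condition.
    have e1 : ∀ c, 2 * (starDeg H ctr t c (insert r T) / 2) + ∑ X ∈ P,
        min (starDeg H ctr t c X) (starDeg H ctr t c (insert r T) - starDeg H ctr t c X) ≤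
        starDeg H ctr t c {r} + 2 * ∑ X ∈ P,
          min (starDeg H ctr t c X) (starDeg H ctr t c (insert r T) / 2) := by
      intro c
      refine two_mul_half_add_sum_min_le P _ ?_
      rw [← starDeg_biUnion H ctr t c hdisj, hun, starDeg_insert hr]
      omega
    have e2 := sum_le_sum fun c (_ : c ∈ univ) => e1 c
    rw [sum_add_distrib, sum_add_distrib, h3, ← mul_sum, ← mul_sum, sum_comm,
      sum_comm (s := univ) (t := P)] at e2
    have e3 : #P * (2 * k) ≤ ∑ X ∈ P, ∑ c,
        min (starDeg H ctr t c X) (starDeg H ctr t c (insert r T) - starDeg H ctr t c X) := by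
      rw [← smul_eq_mul]
      exact card_nsmul_le_sum _ _ _ fun X hX =>
        h1 X (by rw [← hun]; exact subset_biUnion_of_mem id hX) (hne X hX)
    rw [sum_sub_distrib, sum_const, nsmul_eq_mul]
    have e4 : (∑ c, (starDeg H ctr t c (insert r T) / 2)) + #P * k ≤
        k + ∑ X ∈ P, ∑ c, min (starDeg H ctr t c X) (starDeg H ctr t c (insert r T) / 2) := by
      have : #P * (2 * k) = 2 * (#P * k) := by ring
      omega
    have e5 : ((∑ c, (starDeg H ctr t c (insert r T) / 2)) + #P * k : ℤ) ≤
        k + ∑ X ∈ P, ∑ c, min (starDeg H ctr t c X) (starDeg H ctr t c (insert r T) / 2) := by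
      exact_mod_cast e4
    push_cast at e5 ⊢
    linarith

/-- Half-edges directed away from their centers can be chosen, extending a given choice at `r`,
so that every star is balanced and every set of terminals can be left. -/
theorem exists_heads (hr : r ∉ T) (hT : T.Nonempty) (hH : ∀ x ∈ H, t x ∈ insert r T)
    (h1 : ∀ X ⊆ T, X.Nonempty → 2 * k ≤
      ∑ c, min (starDeg H ctr t c X) (starDeg H ctr t c (insert r T) - starDeg H ctr t c X))
    (h2 : ∀ c, 2 * starDeg H ctr t c {r} ≤ starDeg H ctr t c (insert r T))
    (h3 : ∑ c, starDeg H ctr t c {r} = 2 * k) {F₀ : η → Bool}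
    (h4 : #{x ∈ H | t x = r ∧ F₀ x = true} = k) :
    ∃ F : η → Bool, (∀ x ∈ H, t x = r → F x = F₀ x) ∧
      (∀ c, #{x ∈ H | ctr x = c ∧ F x = true} = starDeg H ctr t c (insert r T) / 2) ∧
      ∀ X ⊆ T, X.Nonempty → k + #{x ∈ H | t x ∈ X ∧ F x = true} ≤
        ∑ c, min (starDeg H ctr t c X) (starDeg H ctr t c (insert r T) / 2) := by
  obtain ⟨m, hmT, hm⟩ := exists_inDegree_vector hr hT h1 h2 h3
  set d : C → Finset V → ℕ := starDeg H ctr t with hd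
  set h : C → ℕ := fun c => d c (insert r T) / 2 with hh
  set ρ : C → ℕ := fun c => #{x ∈ H | ctr x = c ∧ t x = r ∧ F₀ x = true} with hρ
  have hρk : ∑ c, ρ c = k := by rw [← h4, card_filter_eq_sum_center H ctr]
  have hρd : ∀ c, ρ c ≤ d c {r} := fun c => card_le_card fun x hx => by
    obtain ⟨g1, g2, g3, -⟩ := mem_filter.1 hx
    exact mem_filter.2 ⟨g1, g2, mem_singleton.2 g3⟩
  have hρh : ∀ c, ρ c ≤ h c := fun c => by
    have := h2 c
    have := hρd c
    simp only [hh]; omega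
  have hins : ∀ c, d c (insert r T) = d c {r} + d c T := fun c => starDeg_insert hr c
  have hsplit : ∀ X ⊆ T, ∀ c, d c T = d c X + d c (T \ X) := by
    intro X hX c
    have := starDeg_union_add_inter H ctr t c X (T \ X)
    rw [union_sdiff_of_subset hX, inter_sdiff_self] at this
    have h0 : starDeg H ctr t c ∅ = 0 := by simp [starDeg]
    simp only [hd]; omega
  have hmT' : ∑ v ∈ T, m v = ∑ c, ((h c : ℤ) - ρ c) := by
    rw [hmT, sum_sub_distrib, ← hρk]; push_cast; rfl
  -- The upper bound on `T \ X`, subtracted from the total on `T`, becomes a lower bound on `X`. It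
  -- is what Hakimi's condition needs, and `S = ∅` gives nonnegativity.
  have hlow : ∀ X ⊆ T, ∀ S : Finset C, ∑ c ∈ S, ((h c : ℤ) - ρ c - d c (T \ X)) ≤ ∑ v ∈ X, m v := by
    intro X hX S
    have g1 : ∑ v ∈ T \ X, m v ≤ ∑ c, min (d c (T \ X) : ℤ) (h c - ρ c) := by
      rcases (T \ X).eq_empty_or_nonempty with he | hne
      · rw [he, sum_empty]
        refine sum_nonneg fun c _ => ?_
        have := hρh c
        omega
      · refine (hm _ sdiff_subset hne).trans ?_
        rw [← hρk]
        push_cast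
        rw [← sum_sub_distrib]
        refine sum_le_sum fun c _ => ?_
        simp only [hh]
        push_cast
        omega
    have g2 : ∑ v ∈ T \ X, m v + ∑ v ∈ X, m v = ∑ v ∈ T, m v := sum_sdiff hX
    have g3 : ∑ c ∈ S, ((h c : ℤ) - ρ c - d c (T \ X)) ≤
        ∑ c, ((h c : ℤ) - ρ c - min (d c (T \ X) : ℤ) (h c - ρ c)) := by
      refine (sum_le_sum fun c _ => ?_).trans
        (sum_le_sum_of_subset_of_nonneg (subset_univ S) fun c _ _ => ?_) <;> omega
    have g4 : ∑ c, ((h c : ℤ) - ρ c - min (d c (T \ X) : ℤ) (h c - ρ c)) =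
        ∑ v ∈ T, m v - ∑ c, min (d c (T \ X) : ℤ) (h c - ρ c) := by
      rw [sum_sub_distrib, hmT']
    linarith
  have hm0 : ∀ v ∈ T, 0 ≤ m v := fun v hv => by
    simpa using hlow {v} (singleton_subset_iff.2 hv) ∅
  let H' : Finset η := {x ∈ H | t x ≠ r}
  have htT : ∀ x ∈ H', t x ∈ T := fun x hx =>
    (mem_insert.1 (hH x (mem_filter.1 hx).1)).resolve_left (mem_filter.1 hx).2
  have hle : ∀ c, h c - ρ c ≤ d c T := fun c => by
    have := h2 c
    have := hins c
    simp only [hh]; omega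
  -- The half-edges at `r` are already fixed. Of the others, the star at `c` should direct `h c - ρ
  -- c` away from `c`, so the cap at `c` is the remaining number.
  obtain ⟨F, hF⟩ := exists_orientation_inDegree_le H' (fun x => (Sum.inl (t x) : V ⊕ C))
    (fun x => Sum.inr (ctr x))
    (Sum.elim (fun v => (m v).toNat) (fun c => d c T - (h c - ρ c))) (by
    intro W
    have g1 : #{x ∈ H' | (Sum.inl (t x) : V ⊕ C) ∈ W ∧ (Sum.inr (ctr x) : V ⊕ C) ∈ W} =
        ∑ c ∈ W.toRight, d c (W.toLeft ∩ T) := by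
      rw [card_eq_sum_card_fiberwise (f := ctr) (t := W.toRight) (fun x hx => by
        simpa using (mem_filter.1 (mem_coe.1 hx)).2.2)]
      refine sum_congr rfl fun c hc => ?_
      rw [filter_filter]
      refine congrArg card (Finset.ext fun x => ?_)
      simp only [H', mem_filter, mem_inter, mem_toLeft]
      rw [mem_toRight] at hc
      constructor
      · rintro ⟨⟨a1, a2⟩, ⟨a3, a4⟩, a5⟩
        exact ⟨a1, a5, a3, htT x (mem_filter.2 ⟨a1, a2⟩)⟩
      · rintro ⟨a1, rfl, a3, a4⟩
        exact ⟨⟨a1, fun he => hr (he ▸ a4)⟩, ⟨a3, hc⟩, rfl⟩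
    have g2 : ∑ w ∈ W, Sum.elim (fun v => (m v).toNat) (fun c => d c T - (h c - ρ c)) w =
        ∑ v ∈ W.toLeft, (m v).toNat + ∑ c ∈ W.toRight, (d c T - (h c - ρ c)) := by
      conv_lhs => rw [← toLeft_disjSum_toRight (u := W), sum_disjSum]
      rfl
    rw [g1, g2]
    have g3 := hlow (W.toLeft ∩ T) inter_subset_right W.toRight
    have g4 : ∑ v ∈ W.toLeft ∩ T, m v ≤ ∑ v ∈ W.toLeft, ((m v).toNat : ℤ) :=
      (sum_le_sum fun v _ => Int.self_le_toNat _).trans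
        (sum_le_sum_of_subset_of_nonneg inter_subset_left fun _ _ _ => by positivity)
    have g5 : ∑ c ∈ W.toRight, (d c (W.toLeft ∩ T) : ℤ) =
        ∑ c ∈ W.toRight, ((h c : ℤ) - ρ c - d c (T \ (W.toLeft ∩ T))) +
        ∑ c ∈ W.toRight, ((d c T - (h c - ρ c) : ℕ) : ℤ) := by
      rw [← sum_add_distrib]
      refine sum_congr rfl fun c _ => ?_
      have := hsplit _ (inter_subset_right (s₁ := W.toLeft) (s₂ := T)) c
      have := hle c
      have := hρh c
      omega
    have g6 : ∑ c ∈ W.toRight, (d c (W.toLeft ∩ T) : ℤ) ≤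
        ∑ v ∈ W.toLeft, ((m v).toNat : ℤ) +
          ∑ c ∈ W.toRight, ((d c T - (h c - ρ c) : ℕ) : ℤ) := by linarith
    exact_mod_cast g6)
  have hFt : ∀ v, #{x ∈ H' | t x = v ∧ F x = true} ≤ (m v).toNat := by
    intro v
    refine le_trans (card_le_card fun x hx => ?_) (hF (Sum.inl v))
    obtain ⟨a1, a2, a3⟩ := mem_filter.1 hx
    exact mem_filter.2 ⟨a1, by simp [a2, a3]⟩
  have hFc : ∀ c, h c - ρ c ≤ #{x ∈ H' | ctr x = c ∧ F x = true} := by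
    intro c
    have g1 : #{x ∈ H' | ctr x = c ∧ F x = false} ≤ d c T - (h c - ρ c) := by
      refine le_trans (card_le_card fun x hx => ?_) (hF (Sum.inr c))
      obtain ⟨a1, a2, a3⟩ := mem_filter.1 hx
      exact mem_filter.2 ⟨a1, by simp [a2, a3]⟩
    have g2 : #{x ∈ H' | ctr x = c ∧ F x = true} + #{x ∈ H' | ctr x = c ∧ F x = false} = d c T := by
      have : d c T = #{x ∈ H' | ctr x = c} := by
        refine congrArg card (Finset.ext fun x => ?_)
        simp only [mem_filter]
        constructor
        · rintro ⟨a1, a2, a3⟩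
          exact ⟨mem_filter.2 ⟨a1, fun he => hr (he ▸ a3)⟩, a2⟩
        · rintro ⟨a1, a2⟩
          exact ⟨(mem_filter.1 a1).1, a2, htT x a1⟩
      rw [this]
      simp only [card_filter, ← sum_add_distrib]
      refine sum_congr rfl fun x _ => ?_
      by_cases a1 : ctr x = c <;> cases F x <;> simp [a1]
    have := hle c
    omega
  -- The caps at the terminals sum to the total of the lower bounds `hFc`, so equality holds at
  -- every center.
  have hFc' : ∀ c, #{x ∈ H' | ctr x = c ∧ F x = true} = h c - ρ c := by
    have g1 : ∑ c, #{x ∈ H' | ctr x = c ∧ F x = true} ≤ ∑ c, (h c - ρ c) := by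
      rw [← card_filter_eq_sum_center H' ctr (fun x => F x = true)]
      have g2 : #{x ∈ H' | F x = true} = #{x ∈ H' | t x ∈ T ∧ F x = true} := by
        refine congrArg card (filter_congr fun x hx => ?_)
        simp [htT x hx]
      rw [g2, card_filter_mem_eq_sum]
      have g3 : ∑ v ∈ T, (#{x ∈ H' | t x = v ∧ F x = true} : ℤ) ≤ ∑ v ∈ T, m v :=
        sum_le_sum fun v hv => by
          have := hFt v
          have := hm0 v hv
          omega
      have g4 : ((∑ c, (h c - ρ c) : ℕ) : ℤ) = ∑ v ∈ T, m v := by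
        rw [hmT']
        push_cast
        exact sum_congr rfl fun c _ => by rw [Nat.cast_sub (hρh c)]
      rw [← g4] at g3
      exact_mod_cast g3
    have g2 := le_antisymm (sum_le_sum fun c (_ : c ∈ univ) => hFc c) g1
    exact fun c => ((sum_eq_sum_iff_of_le fun c _ => hFc c).1 g2 c (mem_univ c)).symm
  refine ⟨fun x => if t x = r then F₀ x else F x, fun x _ hx => by simp [hx], fun c => ?_,
    fun X hX hXne => ?_⟩
  · have g1 : #{x ∈ H | ctr x = c ∧ (if t x = r then F₀ x else F x) = true} =
        ρ c + #{x ∈ H' | ctr x = c ∧ F x = true} := by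
      simp only [hρ, H', filter_filter]
      simp only [card_filter, ← sum_add_distrib]
      refine sum_congr rfl fun x _ => ?_
      by_cases a1 : t x = r <;> by_cases a2 : ctr x = c <;> simp [a1, a2]
    rw [g1, hFc' c]
    have := hρh c
    simp only [hh] at this ⊢
    omega
  · have g1 : #{x ∈ H | t x ∈ X ∧ (if t x = r then F₀ x else F x) = true} =
        #{x ∈ H' | t x ∈ X ∧ F x = true} := by
      refine congrArg card (Finset.ext fun x => ?_)
      simp only [H', mem_filter]
      constructor
      · rintro ⟨a1, a2, a3⟩
        have : t x ≠ r := fun he => hr (he ▸ hX a2)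
        rw [if_neg this] at a3
        exact ⟨⟨a1, this⟩, a2, a3⟩
      · rintro ⟨⟨a1, a2⟩, a3, a4⟩
        exact ⟨a1, a3, by rwa [if_neg a2]⟩
    rw [g1, card_filter_mem_eq_sum]
    have g3 : ∑ v ∈ X, (#{x ∈ H' | t x = v ∧ F x = true} : ℤ) ≤ ∑ v ∈ X, m v :=
      sum_le_sum fun v hv => by
        have := hFt v
        have := hm0 v (hX hv)
        omega
    have g4 := hm X hX hXne
    have g5 : (k : ℤ) + ∑ v ∈ X, (#{x ∈ H' | t x = v ∧ F x = true} : ℤ) ≤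
      ∑ c, ((min (d c X) (d c (insert r T) / 2) : ℕ) : ℤ) := by linarith
    exact_mod_cast g5

end Stars

/-! ### Graphs without edges between non-terminals -/

section Base

variable {V β : Type*} [DecidableEq V]

/-- The tail of the edge `e` with ends `a e` and `b e`, directed towards `b e` if `D e` is true and
towards `a e` otherwise. -/
def tailOf (a b : β → V) (D : β → Bool) (e : β) : V := bif D e then a e else b e

/-- The head of the edge `e` with ends `a e` and `b e`, directed towards `b e` if `D e` is true and
towards `a e` otherwise. -/
def headOf (a b : β → V) (D : β → Bool) (e : β) : V := bif D e then b e else a e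

/-- One end of the edge `x.1`, chosen by `x.2`. -/
def endOf (a b : β → V) (x : β × Bool) : V := bif x.2 then a x.1 else b x.1

/-- The center of the half-edge `x` in the decomposition into stars of a graph all of whose edges
have an end in `R`. Edges with both ends in `R` are stars of their own. -/
def centerOf (a b : β → V) (R : Finset V) (x : β × Bool) : V ⊕ β :=
  if endOf a b (x.1, !x.2) ∈ R then Sum.inr x.1 else Sum.inl (endOf a b (x.1, !x.2))

/-- The half-edges at vertices of `R`. -/
def halfEdges (E : Finset β) (a b : β → V) (R : Finset V) : Finset (β × Bool) :=
  {x ∈ E ×ˢ univ | endOf a b x ∈ R}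

theorem outDeg_tailOf_add (E : Finset β) (a b : β → V) (D : β → Bool) (Z : Finset V) :
    outDeg E (tailOf a b D) (headOf a b D) Z + outDeg E (headOf a b D) (tailOf a b D) Z =
      cutDeg E a b Z := by
  rw [outDeg_add_outDeg_swap]
  simp only [cutDeg, tailOf, headOf]
  refine congrArg card (filter_congr fun e _ => ?_)
  cases D e <;> simp [iff_comm]

theorem card_filter_halfEdges (E : Finset β) (a b : β → V) (R : Finset V) (p : β × Bool → Prop)
    [DecidablePred p] : #{x ∈ halfEdges E a b R | p x} =
      ∑ e ∈ E, ((if a e ∈ R ∧ p (e, true) then 1 else 0) +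
        (if b e ∈ R ∧ p (e, false) then 1 else 0)) := by
  rw [halfEdges, filter_filter, card_filter, sum_product]
  refine sum_congr rfl fun e _ => ?_
  rw [Fintype.sum_bool]
  rfl

variable {E : Finset β} {a b : β → V} {r : V} {T : Finset V}

/-- `σ` says which centers lie on the side of `Z`. Subdividing an edge inside `R` cannot lower the
cut, on whichever side the new center is placed. -/
theorem cutDeg_le_card_halfEdges {R : Finset V} (hE : ∀ e ∈ E, a e ∈ R ∨ b e ∈ R) {X : Finset V}
    (σ : V ⊕ β → Prop) [DecidablePred σ] {Z : Finset V}
    (hZR : ∀ v ∈ R, v ∈ Z ↔ v ∈ X) (hZ : ∀ v ∉ R, v ∈ Z ↔ σ (Sum.inl v)) :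
    cutDeg E a b Z ≤
      #{x ∈ halfEdges E a b R | ¬(endOf a b x ∈ X ↔ σ (centerOf a b R x))} := by
  rw [card_filter_halfEdges, cutDeg, card_filter]
  refine sum_le_sum fun e he => ?_
  have := hE e he
  by_cases h1 : a e ∈ R <;> by_cases h2 : b e ∈ R
  · have e1 := hZR _ h1
    have e2 := hZR _ h2
    by_cases h3 : σ (Sum.inr e) <;> by_cases h4 : a e ∈ X <;> by_cases h5 : b e ∈ X <;>
      simp [endOf, centerOf, *]
  · have e1 := hZR _ h1
    have e2 := hZ _ h2
    by_cases h3 : σ (Sum.inl (b e)) <;> by_cases h4 : a e ∈ X <;> simp [endOf, centerOf, *]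
  · have e1 := hZ _ h1
    have e2 := hZR _ h2
    by_cases h3 : σ (Sum.inl (a e)) <;> by_cases h4 : b e ∈ X <;> simp [endOf, centerOf, *]
  · simp_all

variable [Fintype V] [Fintype β] [DecidableEq β] {k : ℕ} {o : β → Bool}

theorem card_halfEdges_side_eq {R X : Finset V} (σ : V ⊕ β → Prop) [DecidablePred σ] :
    #{x ∈ halfEdges E a b R | ¬(endOf a b x ∈ X ↔ σ (centerOf a b R x))} = ∑ c,
      if σ c then starDeg (halfEdges E a b R) (centerOf a b R) (endOf a b) c R -
        starDeg (halfEdges E a b R) (centerOf a b R) (endOf a b) c X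
      else starDeg (halfEdges E a b R) (centerOf a b R) (endOf a b) c X := by
  rw [card_filter_eq_sum_center _ (centerOf a b R)]
  refine sum_congr rfl fun c _ => ?_
  split_ifs with hc
  · refine Nat.eq_sub_of_add_eq ?_
    simp only [starDeg, card_filter, ← sum_add_distrib]
    refine sum_congr rfl fun x hx => ?_
    have hxR : endOf a b x ∈ R := (mem_filter.1 hx).2
    by_cases h1 : centerOf a b R x = c
    · by_cases h2 : endOf a b x ∈ X <;> simp [h1, h2, hc, hxR]
    · simp [h1]
  · rw [starDeg]
    refine congrArg card (filter_congr fun x _ => ?_)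
    by_cases h1 : centerOf a b R x = c
    · simp [h1, hc]
    · simp [h1]

omit [Fintype V] [Fintype β] [DecidableEq β] in
-- The center of an edge inside `R` is placed on the side of its tail, so only the half at the head
-- can cross, and it crosses exactly when the arc does.
theorem card_halfEdges_le_outDeg {R : Finset V} (hE : ∀ e ∈ E, a e ∈ R ∨ b e ∈ R) (D : β → Bool)
    (Z : Finset V) (σ : V ⊕ β → Prop) [DecidablePred σ] (hσ : ∀ v ∉ R, σ (Sum.inl v) ↔ v ∈ Z)
    (hσ' : ∀ e, σ (Sum.inr e) ↔ tailOf a b D e ∈ Z) :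
    #{x ∈ halfEdges E a b R | D x.1 = x.2 ∧ endOf a b x ∈ Z ∧ ¬σ (centerOf a b R x) ∨
        D x.1 ≠ x.2 ∧ endOf a b x ∉ Z ∧ σ (centerOf a b R x)} ≤
      outDeg E (tailOf a b D) (headOf a b D) Z := by
  rw [card_filter_halfEdges, outDeg, card_filter]
  refine sum_le_sum fun e he => ?_
  have h := hE e he
  have h' := hσ' e
  by_cases k1 : a e ∈ R <;> by_cases k2 : b e ∈ R
  · cases k5 : D e <;> simp only [tailOf, k5, cond_true, cond_false] at h' <;>
      by_cases k3 : a e ∈ Z <;> by_cases k4 : b e ∈ Z <;>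
      simp [endOf, centerOf, tailOf, headOf, k1, k2, k3, k4, k5, h']
  · have h2 := hσ _ k2
    by_cases k3 : a e ∈ Z <;> by_cases k4 : b e ∈ Z <;> cases k5 : D e <;>
      simp [endOf, centerOf, tailOf, headOf, k1, k2, k3, k4, k5, h2]
  · have h2 := hσ _ k1
    by_cases k3 : a e ∈ Z <;> by_cases k4 : b e ∈ Z <;> cases k5 : D e <;>
      simp [endOf, centerOf, tailOf, headOf, k1, k2, k3, k4, k5, h2]
  · exact absurd h (by simp [k1, k2])

omit [Fintype V] [Fintype β] [DecidableEq β] in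
-- All centers of edges inside `R` are placed in `Y`, so the half counted for such an edge has its
-- tail at `r`. Since no loop sits at `r`, the arc does enter `Y`.
theorem card_halfEdges_root_le_outDeg {R : Finset V} (hE : ∀ e ∈ E, a e ∈ R ∨ b e ∈ R)
    (hloop : ∀ e ∈ E, ¬(a e = r ∧ b e = r)) (D : β → Bool) {Y : Finset V}
    (hY : ∀ v ∈ R, v = r ↔ v ∉ Y)
    (σ : V ⊕ β → Prop) [DecidablePred σ] (hσ : ∀ v ∉ R, σ (Sum.inl v) ↔ v ∈ Y)
    (hσ' : ∀ e, σ (Sum.inr e)) :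
    #{x ∈ halfEdges E a b R | D x.1 = x.2 ∧ endOf a b x = r ∧ σ (centerOf a b R x) ∨
        D x.1 ≠ x.2 ∧ endOf a b x ≠ r ∧ ¬σ (centerOf a b R x)} ≤
      outDeg E (headOf a b D) (tailOf a b D) Y := by
  rw [card_filter_halfEdges, outDeg, card_filter]
  refine sum_le_sum fun e he => ?_
  have h := hE e he
  have h' := hσ' e
  have hl := hloop e he
  by_cases k1 : a e ∈ R <;> by_cases k2 : b e ∈ R
  · rw [hY _ k1, hY _ k2] at hl
    by_cases k3 : a e ∈ Y <;> by_cases k4 : b e ∈ Y <;> cases k5 : D e <;>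
      simp [endOf, centerOf, tailOf, headOf, k1, k2, k3, k4, k5, h', hY _ k1, hY _ k2] at hl ⊢
  · have h2 := hσ _ k2
    by_cases k3 : a e ∈ Y <;> by_cases k4 : b e ∈ Y <;> cases k5 : D e <;>
      simp [endOf, centerOf, tailOf, headOf, k1, k2, k3, k4, k5, h2, hY _ k1]
  · have h2 := hσ _ k1
    by_cases k3 : a e ∈ Y <;> by_cases k4 : b e ∈ Y <;> cases k5 : D e <;>
      simp [endOf, centerOf, tailOf, headOf, k1, k2, k3, k4, k5, h2, hY _ k2]
  · exact absurd h (by simp [k1, k2])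

omit [Fintype V] [Fintype β] in
/-- Balanced sets of half-edges come from orientations. -/
theorem exists_orientation_of_heads {R : Finset V} {F : β × Bool → Bool}
    (hF : ∀ e, #{x ∈ halfEdges E a b R | centerOf a b R x = Sum.inr e ∧ F x = true} =
      starDeg (halfEdges E a b R) (centerOf a b R) (endOf a b) (Sum.inr e) R / 2) :
    ∃ D : β → Bool, ∀ x ∈ halfEdges E a b R, F x = (D x.1 != x.2) := by
  refine ⟨fun e => if b e ∈ R then F (e, false) else !F (e, true), ?_⟩
  rintro ⟨e, i⟩ hx
  have heE : e ∈ E := (mem_product.1 (mem_filter.1 hx).1).1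
  have hxR : endOf a b (e, i) ∈ R := (mem_filter.1 hx).2
  cases i
  · have : b e ∈ R := hxR
    simp [this]
  · have haR : a e ∈ R := hxR
    by_cases hbR : b e ∈ R
    · have g1 := hF e
      have g2 : ∀ x : β × Bool, x ∈ halfEdges E a b R ∧ centerOf a b R x = Sum.inr e ↔
          x ∈ ({(e, true), (e, false)} : Finset (β × Bool)) := by
        rintro ⟨e', i⟩
        rw [mem_insert, mem_singleton]
        constructor
        · rintro ⟨-, g⟩
          have : e' = e := by
            simp only [centerOf] at g
            split_ifs at g
            exact Sum.inr.inj g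
          subst this
          cases i <;> simp
        · rintro (g | g) <;> cases g
          · exact ⟨hx, by simp [centerOf, endOf, hbR]⟩
          · exact ⟨mem_filter.2 ⟨by simp [heE], hbR⟩, by simp [centerOf, endOf, haR]⟩
      -- A subdivided edge is a star of degree two. Balance directs exactly one half away from its
      -- center, so the halves form one arc.
      have g3 : starDeg (halfEdges E a b R) (centerOf a b R) (endOf a b) (Sum.inr e) R = 2 := by
        have : {x ∈ halfEdges E a b R | centerOf a b R x = Sum.inr e ∧ endOf a b x ∈ R} =
            ({(e, true), (e, false)} : Finset (β × Bool)) := by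
          ext x
          rw [mem_filter, ← g2]
          exact ⟨fun h => ⟨h.1, h.2.1⟩, fun h => ⟨h.1, h.2, (mem_filter.1 h.1).2⟩⟩
        rw [starDeg, this]; simp
      have g4 : {x ∈ halfEdges E a b R | centerOf a b R x = Sum.inr e ∧ F x = true} =
          {x ∈ ({(e, true), (e, false)} : Finset (β × Bool)) | F x = true} := by
        ext x
        rw [mem_filter, mem_filter, ← g2, and_assoc]
      rw [g4, g3] at g1
      simp only [hbR, if_true]
      cases g5 : F (e, true) <;> cases g6 : F (e, false) <;>
        simp [filter_insert, filter_singleton, g5, g6] at g1 ⊢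
    · simp [hbR]

/-- The extension theorem for graphs in which every edge has an end in `insert r T`. -/
theorem exists_extension_of_no_steiner_edge (hr : r ∉ T) (hT : T.Nonempty)
    (hE : ∀ e ∈ E, a e ∈ insert r T ∨ b e ∈ insert r T)
    (hloop : ∀ e ∈ E, ¬(a e = r ∧ b e = r))
    (hcut : ∀ Z, r ∉ Z → (Z ∩ T).Nonempty → 2 * k ≤ cutDeg E a b Z)
    (hrcut : cutDeg E a b {r} = 2 * k)
    (hro : outDeg E (tailOf a b o) (headOf a b o) {r} = k) :
    ∃ D : β → Bool, (∀ e ∈ E, ¬(a e = r ↔ b e = r) → D e = o e) ∧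
      (∀ Z, r ∉ Z → (Z ∩ T).Nonempty → k ≤ outDeg E (tailOf a b D) (headOf a b D) Z) ∧
      ∀ Y, r ∉ Y → T ⊆ Y → k ≤ outDeg E (headOf a b D) (tailOf a b D) Y := by
  set R := insert r T with hR
  set H := halfEdges E a b R with hH
  set ctr := centerOf a b R with hctr
  set t := endOf a b with ht
  have hrR : r ∈ R := mem_insert_self _ _
  have hTR : T ⊆ R := subset_insert _ _
  have hHR : ∀ x ∈ H, t x ∈ R := fun x hx => (mem_filter.1 hx).2
  have hmono : ∀ c, ∀ X ⊆ R, starDeg H ctr t c X ≤ starDeg H ctr t c R :=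
    fun c X hX => starDeg_mono _ _ _ _ hX
  have hcardr : #{x ∈ H | t x = r} = 2 * k := by
    rw [← hrcut, card_filter_halfEdges, cutDeg, card_filter]
    refine sum_congr rfl fun e he => ?_
    have := hloop e he
    by_cases h1 : a e = r <;> by_cases h2 : b e = r <;> simp_all [endOf]
  have hcenter : ∀ p : β × Bool → Prop, ∀ _ : DecidablePred p,
      #{x ∈ H | p x} = ∑ c, #{x ∈ H | ctr x = c ∧ p x} :=
    fun p _ => card_filter_eq_sum_center H ctr p
  have h3 : ∑ c, starDeg H ctr t c {r} = 2 * k := by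
    rw [← hcardr, hcenter]
    simp [starDeg]
  have h1 : ∀ X ⊆ T, X.Nonempty → 2 * k ≤
      ∑ c, min (starDeg H ctr t c X) (starDeg H ctr t c R - starDeg H ctr t c X) := by
    intro X hX hXne
    -- Each center goes to the side where its star contributes the smaller number to the cut.
    let σ : V ⊕ β → Prop := fun c => starDeg H ctr t c R < 2 * starDeg H ctr t c X
    let Z : Finset V := {v | v ∈ X ∨ v ∉ R ∧ σ (Sum.inl v)}
    have g1 := cutDeg_le_card_halfEdges (R := R) hE (X := X) σ (Z := Z)
      (by intro v hv; simp [Z, hv])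
      (by
        intro v hv
        have : v ∉ X := fun h => hv (hTR (hX h))
        simp [Z, hv, this])
    rw [card_halfEdges_side_eq σ] at g1
    have hrX : r ∉ X := fun h => hr (hX h)
    obtain ⟨v, hv⟩ := hXne
    have g2 := hcut Z (by simp [Z, hrR, hrX]) ⟨v, mem_inter.2 ⟨by simp [Z, hv], hX hv⟩⟩
    refine g2.trans (g1.trans (sum_le_sum fun c _ => ?_))
    have := hmono c X (hX.trans hTR)
    simp only [σ]
    split_ifs with hs <;> simp only [← hH, ← hctr, ← ht] <;> omega
  have h2 : ∀ c, 2 * starDeg H ctr t c {r} ≤ starDeg H ctr t c R := by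
    intro c
    -- Moving `c` to the side of `r` cannot lower the cut below `2 * k`, the degree of `r`.
    let Z : Finset V := {v | v = r ∨ v ∉ R ∧ Sum.inl v = c}
    have g1 := cutDeg_le_card_halfEdges (R := R) hE (X := {r}) (fun c' => c' = c) (Z := Z)
      (by intro v hv; simp [Z, hv])
      (by
        intro v hv
        have : v ≠ r := fun h => hv (h ▸ hrR)
        simp [Z, hv, this])
    have g0 := card_halfEdges_side_eq (E := E) (a := a) (b := b) (R := R) (X := {r})
      (fun c' => c' = c)
    rw [g0] at g1
    simp only [← hH, ← hctr, ← ht] at g1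
    have g2 := hcut Zᶜ (by simp [Z]) (by
      obtain ⟨v, hv⟩ := hT
      refine ⟨v, mem_inter.2 ⟨?_, hv⟩⟩
      have : v ≠ r := fun h => hr (h ▸ hv)
      simp [Z, this, hTR hv])
    have g3 : cutDeg E a b Zᶜ = cutDeg E a b Z := by
      rw [cutDeg, cutDeg]
      refine congrArg card (filter_congr fun e _ => ?_)
      simp only [mem_compl, not_iff_not]
    rw [g3] at g2
    rw [← add_sum_erase _ _ (mem_univ c)] at h3 g1
    have g4 : ∑ x ∈ univ.erase c, (if x = c then starDeg H ctr t x R - starDeg H ctr t x {r}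
        else starDeg H ctr t x {r}) = ∑ x ∈ univ.erase c, starDeg H ctr t x {r} :=
      sum_congr rfl fun x hx => if_neg (ne_of_mem_erase hx)
    rw [if_pos rfl, g4] at g1
    have := hmono c {r} (singleton_subset_iff.2 hrR)
    omega
  -- `D x.1 != x.2` says that the end of the half-edge `x` is the head of its arc, so that `x` is
  -- directed away from its center.
  have h4 : #{x ∈ H | t x = r ∧ (fun x : β × Bool => o x.1 != x.2) x = true} = k := by
    have g1 := outDeg_tailOf_add E a b o {r}
    have g2 : outDeg E (headOf a b o) (tailOf a b o) {r} = k := by omega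
    rw [← g2, card_filter_halfEdges, outDeg, card_filter]
    refine sum_congr rfl fun e he => ?_
    have := hloop e he
    have e1 : t (e, true) = a e := rfl
    have e2 : t (e, false) = b e := rfl
    by_cases g3 : a e = r <;> by_cases g4 : b e = r
    · exact absurd ⟨g3, g4⟩ this
    all_goals
      obtain g5 | g5 : o e = true ∨ o e = false := by cases o e <;> simp
      all_goals simp [e1, e2, headOf, tailOf, g3, g4, g5, hrR]
  obtain ⟨F, hF1, hF2, hF3⟩ := exists_heads hr hT hHR h1 h2 h3 h4
  obtain ⟨D, hD⟩ := exists_orientation_of_heads (E := E) (a := a) (b := b) (R := R) (F := F)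
    fun e => hF2 (Sum.inr e)
  have hDF : ∀ x ∈ H, (F x = true ↔ D x.1 ≠ x.2) := fun x hx => by
    rw [hD x hx]; simp
  have hDF' : ∀ x ∈ H, (F x = false ↔ D x.1 = x.2) := fun x hx => by
    rw [hD x hx]; simp
  refine ⟨D, fun e he hcross => ?_, fun Z hZ hZT => ?_, fun Y hY hTY => ?_⟩
  · have : ∃ i, (e, i) ∈ H ∧ t (e, i) = r := by
      by_cases g1 : a e = r
      · exact ⟨true, mem_filter.2 ⟨by simp [he], by simp [endOf, g1, hrR]⟩, g1⟩
      · have g2 : b e = r := by tauto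
        exact ⟨false, mem_filter.2 ⟨by simp [he], by simp [endOf, g2, hrR]⟩, g2⟩
    obtain ⟨i, hi, hir⟩ := this
    have g1 := hD _ hi
    rw [hF1 _ hi hir] at g1
    simp only at g1
    revert g1
    cases D e <;> cases o e <;> cases i <;> simp
  · let X := Z ∩ T
    have hXT : X ⊆ T := inter_subset_right
    let σ : V ⊕ β → Prop := Sum.elim (· ∈ Z) (fun e => tailOf a b D e ∈ Z)
    have hσ : DecidablePred σ := Classical.decPred σ
    have g1 : #{x ∈ H | F x = false ∧ t x ∈ X ∧ ¬σ (ctr x) ∨ F x = true ∧ t x ∉ X ∧ σ (ctr x)} ≤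
        outDeg E (tailOf a b D) (headOf a b D) Z := by
      have : {x ∈ H | F x = false ∧ t x ∈ X ∧ ¬σ (ctr x) ∨ F x = true ∧ t x ∉ X ∧ σ (ctr x)} =
          {x ∈ H | D x.1 = x.2 ∧ t x ∈ Z ∧ ¬σ (ctr x) ∨ D x.1 ≠ x.2 ∧ t x ∉ Z ∧ σ (ctr x)} := by
        refine filter_congr fun x hx => ?_
        have e1 := hDF x hx
        have e2 : t x ∈ X ↔ t x ∈ Z := by
          have := hHR x hx
          simp only [X, mem_inter, hR, mem_insert] at this ⊢
          refine ⟨fun h => h.1, fun h => ⟨h, this.resolve_left fun h' => hZ (h' ▸ h)⟩⟩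
        rw [e1, e2, hDF' x hx]
      rw [this]
      exact card_halfEdges_le_outDeg hE D Z σ (fun _ _ => Iff.rfl) fun _ => Iff.rfl
    refine le_trans ?_ g1
    rw [hcenter]
    have g2 := hF3 X hXT hZT
    rw [hcenter, ← hR] at g2
    -- A center in `Z` sends its `d / 2` outgoing half-edges out of `Z` except those with head in
    -- `X`. A center outside `Z` receives all half-edges at `X` except those with head in `X`.
    have g3 : ∀ c, min (starDeg H ctr t c X) (starDeg H ctr t c R / 2) ≤
        #{x ∈ H | ctr x = c ∧
          (F x = false ∧ t x ∈ X ∧ ¬σ (ctr x) ∨ F x = true ∧ t x ∉ X ∧ σ (ctr x))} +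
        #{x ∈ H | ctr x = c ∧ t x ∈ X ∧ F x = true} := by
      intro c
      by_cases hc : σ c
      · refine (min_le_right _ _).trans ?_
        rw [hR, ← hF2 c]
        simp only [card_filter, ← sum_add_distrib]
        refine sum_le_sum fun x _ => ?_
        by_cases k1 : ctr x = c <;> by_cases k2 : t x ∈ X <;> cases k3 : F x <;>
          simp [k1, k2, hc]
      · refine (min_le_left _ _).trans ?_
        simp only [starDeg, card_filter, ← sum_add_distrib]
        refine sum_le_sum fun x _ => ?_
        by_cases k1 : ctr x = c <;> by_cases k2 : t x ∈ X <;> cases k3 : F x <;>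
          simp [k1, k2, hc]
    have g4 := sum_le_sum fun c (_ : c ∈ univ) => g3 c
    rw [sum_add_distrib] at g4
    omega
  · let σ : V ⊕ β → Prop := Sum.elim (· ∈ Y) (fun _ => True)
    have hσ : DecidablePred σ := Classical.decPred σ
    have g1 : #{x ∈ H | F x = false ∧ t x = r ∧ σ (ctr x) ∨ F x = true ∧ t x ≠ r ∧ ¬σ (ctr x)} ≤
        outDeg E (headOf a b D) (tailOf a b D) Y := by
      have : {x ∈ H | F x = false ∧ t x = r ∧ σ (ctr x) ∨ F x = true ∧ t x ≠ r ∧ ¬σ (ctr x)} =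
          {x ∈ H | D x.1 = x.2 ∧ t x = r ∧ σ (ctr x) ∨ D x.1 ≠ x.2 ∧ t x ≠ r ∧ ¬σ (ctr x)} := by
        refine filter_congr fun x hx => ?_
        have e1 := hDF x hx
        rw [e1, hDF' x hx]
      rw [this]
      refine card_halfEdges_root_le_outDeg hE hloop D (fun v hv => ⟨?_, fun h => ?_⟩) σ
        (fun _ _ => Iff.rfl) fun _ => trivial
      · rintro rfl; exact hY
      · exact (mem_insert.1 hv).resolve_right fun h' => h (hTY h')
    refine le_trans ?_ g1
    rw [hcenter]
    have g2 : #{x ∈ H | t x = r ∧ F x = false} = k := by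
      have e1 : #{x ∈ H | t x = r ∧ F x = true} = k := by
        rw [← h4]
        refine congrArg card (filter_congr fun x hx => ?_)
        exact and_congr_right fun h => by rw [hF1 x hx h]
      have e2 : #{x ∈ H | t x = r ∧ F x = true} + #{x ∈ H | t x = r ∧ F x = false} =
          #{x ∈ H | t x = r} := by
        simp only [card_filter, ← sum_add_distrib]
        refine sum_congr rfl fun x _ => ?_
        by_cases k1 : t x = r <;> cases k2 : F x <;> simp [k1]
      omega
    rw [hcenter] at g2
    -- The `k` half-edges leaving `r` are charged star by star. If the center is outside `Y`,
    -- balance and `h2` give at least as many half-edges from it to terminals.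
    refine g2.symm.le.trans (sum_le_sum fun c _ => ?_)
    by_cases hc : σ c
    · refine card_le_card fun x hx => ?_
      simp only [mem_filter] at hx ⊢
      obtain ⟨k1, rfl, k3, k4⟩ := hx
      exact ⟨k1, rfl, Or.inl ⟨k4, k3, hc⟩⟩
    · have e1 := hF2 c
      have e2 := h2 c
      have e3 : starDeg H ctr t c {r} = #{x ∈ H | ctr x = c ∧ t x = r ∧ F x = false} +
          #{x ∈ H | ctr x = c ∧ t x = r ∧ F x = true} := by
        simp only [starDeg, card_filter, ← sum_add_distrib]
        refine sum_congr rfl fun x _ => ?_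
        by_cases k1 : t x = r <;> by_cases k3 : ctr x = c <;> cases k2 : F x <;> simp [k1, k3]
      have e4 : #{x ∈ H | ctr x = c ∧ F x = true} ≤
          #{x ∈ H | ctr x = c ∧
            (F x = false ∧ t x = r ∧ σ (ctr x) ∨ F x = true ∧ t x ≠ r ∧ ¬σ (ctr x))} +
          #{x ∈ H | ctr x = c ∧ t x = r ∧ F x = true} := by
        simp only [card_filter, ← sum_add_distrib]
        refine sum_le_sum fun x _ => ?_
        by_cases k1 : ctr x = c <;> by_cases k2 : t x = r <;> cases k3 : F x <;>
          simp [k1, k2, hc]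
      rw [← hR] at e1
      omega

end Base

/-! ### Extending an orientation by deletion and contraction -/

section Extension

variable {V β : Type*} [DecidableEq V]

theorem outDeg_congr {E : Finset β} {a b : β → V} {D D' : β → Bool} {Z : Finset V}
    (h : ∀ e ∈ E, ¬(a e ∈ Z ↔ b e ∈ Z) → D e = D' e) :
    outDeg E (tailOf a b D) (headOf a b D) Z = outDeg E (tailOf a b D') (headOf a b D') Z ∧
      outDeg E (headOf a b D) (tailOf a b D) Z = outDeg E (headOf a b D') (tailOf a b D') Z := by
  constructor <;>
  · refine congrArg card (filter_congr fun e he => ?_)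
    by_cases h1 : a e ∈ Z ↔ b e ∈ Z
    · cases h2 : D e <;> cases h3 : D' e <;> simp [tailOf, headOf, h2, h3, h1]
    · simp [tailOf, headOf, h e he h1]

theorem outDeg_comp {E : Finset β} {s t : β → V} {π : V → V} {Z W : Finset V}
    (h : ∀ v, π v ∈ W ↔ v ∈ Z) : outDeg E (π ∘ s) (π ∘ t) W = outDeg E s t Z := by
  simp only [outDeg, Function.comp, h]

theorem cutDeg_comp {E : Finset β} {a b : β → V} {π : V → V} {Z W : Finset V}
    (h : ∀ v, π v ∈ W ↔ v ∈ Z) : cutDeg E (π ∘ a) (π ∘ b) W = cutDeg E a b Z := by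
  simp only [cutDeg, Function.comp, h]

omit [DecidableEq V] in
theorem tailOf_comp (π : V → V) (a b : β → V) (D : β → Bool) :
    tailOf (π ∘ a) (π ∘ b) D = π ∘ tailOf a b D := by
  ext e; simp only [tailOf, Function.comp]; cases D e <;> rfl

omit [DecidableEq V] in
theorem headOf_comp (π : V → V) (a b : β → V) (D : β → Bool) :
    headOf (π ∘ a) (π ∘ b) D = π ∘ headOf a b D := by
  ext e; simp only [headOf, Function.comp]; cases D e <;> rfl

theorem outDeg_update_not [DecidableEq β] {E : Finset β} {a b : β → V} {D : β → Bool} {e : β}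
    (he : e ∈ E) (Z : Finset V) :
    outDeg E (tailOf a b (Function.update D e !D e)) (headOf a b (Function.update D e !D e)) Z +
        (if tailOf a b D e ∈ Z ∧ headOf a b D e ∉ Z then 1 else 0) =
      outDeg E (tailOf a b D) (headOf a b D) Z +
        (if headOf a b D e ∈ Z ∧ tailOf a b D e ∉ Z then 1 else 0) := by
  simp only [outDeg, card_filter]
  rw [← add_sum_erase _ _ he, ← add_sum_erase E (fun e => if tailOf a b D e ∈ Z ∧ _ then _ else _) he]
  have h1 : tailOf a b (Function.update D e !D e) e = headOf a b D e := by
    simp only [tailOf, headOf, Function.update_self]; cases D e <;> rfl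
  have h2 : headOf a b (Function.update D e !D e) e = tailOf a b D e := by
    simp only [tailOf, headOf, Function.update_self]; cases D e <;> rfl
  rw [h1, h2]
  have h3 : ∀ f ∈ E.erase e, tailOf a b (Function.update D e !D e) f = tailOf a b D f ∧
      headOf a b (Function.update D e !D e) f = headOf a b D f := by
    intro f hf
    simp [tailOf, headOf, Function.update_of_ne (ne_of_mem_erase hf)]
  have h4 := sum_congr rfl fun f hf => (show (if tailOf a b (Function.update D e !D e) f ∈ Z ∧
      headOf a b (Function.update D e !D e) f ∉ Z then 1 else 0) =
      (if tailOf a b D f ∈ Z ∧ headOf a b D f ∉ Z then 1 else 0) by rw [(h3 f hf).1, (h3 f hf).2])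
  rw [h4]
  omega

/-- The orientation `D` extends the orientation `o` at `r`, at least `k` arcs leave each set that
avoids `r` and meets `T`, and at least `k` arcs enter each set that avoids `r` and contains `T`. -/
structure IsExtension (E : Finset β) (a b : β → V) (r : V) (T : Finset V) (k : ℕ)
    (o D : β → Bool) : Prop where
  agree : ∀ e ∈ E, ¬(a e = r ↔ b e = r) → D e = o e
  le_out : ∀ Z, r ∉ Z → (Z ∩ T).Nonempty → k ≤ outDeg E (tailOf a b D) (headOf a b D) Z
  le_in : ∀ Y, r ∉ Y → T ⊆ Y → k ≤ outDeg E (headOf a b D) (tailOf a b D) Y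

variable {E : Finset β} {a b : β → V} {r : V} {T : Finset V} {k : ℕ} {o : β → Bool}

/-- An extension can be chosen with exactly `k` arcs leaving a given terminal. -/
theorem IsExtension.exists_outDeg_eq [DecidableEq β] {D : β → Bool}
    (hD : IsExtension E a b r T k o D) (hr : r ∉ T)
    (hro : outDeg E (headOf a b o) (tailOf a b o) {r} ≤ k) {x : V} (hx : x ∈ T) :
    ∃ D, IsExtension E a b r T k o D ∧ outDeg E (tailOf a b D) (headOf a b D) {x} = k := by
  classical
  have hxr : x ≠ r := fun h => hr (h ▸ hx)
  have hex : ∃ n, ∃ D, IsExtension E a b r T k o D ∧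
      outDeg E (tailOf a b D) (headOf a b D) {x} = n := ⟨_, D, hD, rfl⟩
  clear hD D
  obtain ⟨D, hD, hDn⟩ := Nat.find_spec hex
  have hmin := fun m => Nat.find_min hex (m := m)
  rw [← hDn] at hmin
  refine ⟨D, hD, le_antisymm ?_ (hD.le_out {x} (by simpa using hxr.symm)
    ⟨x, by simp [hx]⟩)⟩
  by_contra! hlt
  have hDr : outDeg E (headOf a b D) (tailOf a b D) {r} ≤ k := by
    rw [(outDeg_congr fun e he h => hD.agree e he (by simpa using h)).2]
    exact hro
  -- More than `k` arcs leave `x` and at most `k` enter `r`, so some arc leaving `x` has its head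
  -- elsewhere.
  have hq : ∃ e ∈ E, tailOf a b D e = x ∧ (headOf a b D e ≠ r ∧ headOf a b D e ≠ x) := by
    by_contra! h
    refine absurd hDr (not_le.2 (hlt.trans_le (card_le_card fun e he => ?_)))
    obtain ⟨h1, h2, h3⟩ := mem_filter.1 he
    rw [mem_singleton] at h2 h3
    have h4 : headOf a b D e = r := by
      by_contra h5
      exact h3 (h e h1 h2 h5)
    exact mem_filter.2 ⟨h1, by simp [h4], by simp [h2, hxr]⟩
  obtain ⟨Z, ⟨hZ1, -⟩, hZ2, hZ3, hZ4⟩ := exists_tight_of_forall_arc (k := k)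
    (p := fun Z => r ∉ Z ∧ x ∈ Z) (v := x)
    (by
      rintro Z W ⟨h1, h2⟩ ⟨h3, h4⟩ - -
      simp [h1, h2, h3, h4])
    (fun Z hZ => hD.le_out Z hZ.1 ⟨x, mem_inter.2 ⟨hZ.2, hx⟩⟩) hq (by
      rintro e he hex' ⟨h1, h2⟩
      -- If the arc left no tight set, reversing it would give an extension with fewer arcs leaving
      -- `x`. Sets containing `T` contain `x`, so no entering arcs are lost there.
      by_contra! hno
      have hflip := outDeg_update_not (a := a) (b := b) (D := D) he
      refine hmin _ ?_ ⟨Function.update D e !D e, ⟨fun f hf hfr => ?_, fun Z hZ hZT => ?_,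
        fun Y hY hTY => ?_⟩, rfl⟩
      · have := hflip {x}
        simp only [mem_singleton, hex', h2, not_true_eq_false, not_false_eq_true, and_self,
          if_true, if_false] at this
        omega
      · by_cases hfe : f = e
        · subst hfe
          have h3 : tailOf a b D f ≠ r := hex' ▸ hxr
          exfalso
          revert hfr h1 h3
          simp only [tailOf, headOf]
          cases D f <;> simp +contextual <;> tauto
        · rw [Function.update_of_ne hfe]
          exact hD.agree f hf hfr
      · have h3 := hflip Z
        have h4 := hD.le_out Z hZ hZT
        by_cases h5 : tailOf a b D e ∈ Z ∧ headOf a b D e ∉ Z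
        · have h6 := hno Z ⟨hZ, hex' ▸ h5.1⟩ (hex' ▸ h5.1) h5.2
          rw [if_pos h5] at h3
          omega
        · rw [if_neg h5] at h3
          omega
      · have h3 := hD.le_in Y hY hTY
        have h4 := outDeg_add_outDeg_swap E (tailOf a b D) (headOf a b D) Y
        have h5 := hflip Y
        have h6 : ¬(headOf a b D e ∈ Y ∧ tailOf a b D e ∉ Y) :=
          fun h => h.2 (hex' ▸ hTY hx)
        rw [if_neg h6] at h5
        have h7 := outDeg_tailOf_add E a b D Y
        have h8 := outDeg_tailOf_add E a b (Function.update D e !D e) Y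
        omega)
  have hle : outDeg E (tailOf a b D) (headOf a b D) {x} ≤
      outDeg E (tailOf a b D) (headOf a b D) Z := by
    refine card_le_card fun e he => ?_
    obtain ⟨h1, h2, h3⟩ := mem_filter.1 he
    rw [mem_singleton] at h2 h3
    refine mem_filter.2 ⟨h1, h2 ▸ hZ2, ?_⟩
    by_cases h4 : headOf a b D e = r
    · rw [h4]; exact hZ1
    · exact hZ4 e h1 h2 ⟨h4, h3⟩
  omega

/-- A contraction creates no new edge between non-terminals, and it destroys `e` because an end of
`e` is mapped to a terminal or to the root. -/
theorem card_steiner_edges_comp_lt {π : V → V} {T' : Finset V} {p : V → Prop}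
    (h : ∀ v, π v ∉ insert r T' → v ∉ insert r T ∧ p v) {e : β} (he : e ∈ E)
    (hea : a e ∉ insert r T) (heb : b e ∉ insert r T) (hp : ¬(p (a e) ∧ p (b e))) :
    #{e ∈ E | (π ∘ a) e ∉ insert r T' ∧ (π ∘ b) e ∉ insert r T'} <
      #{e ∈ E | a e ∉ insert r T ∧ b e ∉ insert r T} := by
  refine card_lt_card ⟨fun f hf => ?_, fun hsub => ?_⟩
  · obtain ⟨h1, h2, h3⟩ := mem_filter.1 hf
    exact mem_filter.2 ⟨h1, (h _ h2).1, (h _ h3).1⟩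
  · obtain ⟨-, h2, h3⟩ := mem_filter.1 (hsub (mem_filter.2 ⟨he, hea, heb⟩))
    exact hp ⟨(h _ h2).2, (h _ h3).2⟩

/-- Extensions of the two contractions at a tight set `X` combine to an extension. -/
theorem IsExtension.combine {X : Finset V} (hrX : r ∉ X) {x₀ : V} (hx₀ : x₀ ∈ X) (hx₀T : x₀ ∈ T)
    (hX : cutDeg E a b X = 2 * k) {π₁ π₂ : V → V} (hπ₁ : ∀ v, π₁ v = if v ∈ X then x₀ else v)
    (hπ₂ : ∀ v, π₂ v = if v ∈ X then v else r) {D₁ D₂ : β → Bool}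
    (h₁ : IsExtension E (π₁ ∘ a) (π₁ ∘ b) r (T.image π₁) k o D₁)
    (hout : outDeg E (tailOf a b D₁) (headOf a b D₁) X = k)
    (h₂ : IsExtension E (π₂ ∘ a) (π₂ ∘ b) r (T ∩ X) k D₁ D₂) :
    ∃ D, IsExtension E a b r T k o D := by
  have e₁ : ∀ W, Disjoint W X ∨ X ⊆ W → ∀ v, π₁ v ∈ W ↔ v ∈ W := by
    intro W hW v
    rw [hπ₁]
    split_ifs with hv
    · rcases hW with hW | hW
      · exact iff_of_false (fun h => disjoint_left.1 hW h hx₀) (fun h => disjoint_left.1 hW h hv)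
      · exact iff_of_true (hW hx₀) (hW hv)
    · rfl
  have e₂ : ∀ W ⊆ X, ∀ v, π₂ v ∈ W ↔ v ∈ W := by
    intro W hW v
    rw [hπ₂]
    split_ifs with hv
    · rfl
    · exact iff_of_false (fun h => hrX (hW h)) (fun h => hv (hW h))
  let D : β → Bool := fun e => if a e ∈ X ∧ b e ∈ X then D₂ e else D₁ e
  have d₁ : ∀ W, Disjoint W X ∨ X ⊆ W →
      outDeg E (tailOf a b D) (headOf a b D) W =
        outDeg E (tailOf (π₁ ∘ a) (π₁ ∘ b) D₁) (headOf (π₁ ∘ a) (π₁ ∘ b) D₁) W ∧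
      outDeg E (headOf a b D) (tailOf a b D) W =
        outDeg E (headOf (π₁ ∘ a) (π₁ ∘ b) D₁) (tailOf (π₁ ∘ a) (π₁ ∘ b) D₁) W := by
    intro W hW
    rw [tailOf_comp, headOf_comp, outDeg_comp (e₁ W hW), outDeg_comp (e₁ W hW)]
    refine outDeg_congr fun e _ h => if_neg fun hX => h ?_
    rcases hW with hW | hW
    · exact iff_of_false (disjoint_right.1 hW hX.1) (disjoint_right.1 hW hX.2)
    · exact iff_of_true (hW hX.1) (hW hX.2)
  have d₂ : ∀ W ⊆ X,
      outDeg E (tailOf a b D) (headOf a b D) W =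
        outDeg E (tailOf (π₂ ∘ a) (π₂ ∘ b) D₂) (headOf (π₂ ∘ a) (π₂ ∘ b) D₂) W ∧
      outDeg E (headOf a b D) (tailOf a b D) W =
        outDeg E (headOf (π₂ ∘ a) (π₂ ∘ b) D₂) (tailOf (π₂ ∘ a) (π₂ ∘ b) D₂) W := by
    intro W hW
    rw [tailOf_comp, headOf_comp, outDeg_comp (e₂ W hW), outDeg_comp (e₂ W hW)]
    refine outDeg_congr fun e he h => ?_
    by_cases hX : a e ∈ X ∧ b e ∈ X
    · exact if_pos hX
    · have : D e = D₁ e := if_neg hX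
      rw [this]
      refine (h₂.agree e he ?_).symm
      have hr : ∀ v, π₂ v = r ↔ v ∉ X := by
        intro v
        rw [hπ₂]
        split_ifs with hv
        · exact iff_of_false (fun h => hrX (h ▸ hv)) (not_not.2 hv)
        · exact iff_of_true rfl hv
      simp only [Function.comp, hr]
      have h3 := @hW (a e)
      have h4 := @hW (b e)
      tauto
  have hoX : outDeg E (tailOf a b D) (headOf a b D) X = k := by
    rw [(d₁ X (Or.inr subset_rfl)).1, tailOf_comp, headOf_comp,
      outDeg_comp (e₁ X (Or.inr subset_rfl)), hout]
  have hiX : outDeg E (headOf a b D) (tailOf a b D) X = k := by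
    have := outDeg_tailOf_add E a b D X
    omega
  refine ⟨D, fun e he h => ?_, fun Z hZ hZT => ?_, fun Y hY hTY => ?_⟩
  · have hr : ∀ v, π₁ v = r ↔ v = r := by
      intro v
      rw [hπ₁]
      split_ifs with hv
      · exact iff_of_false (fun h => hrX (h ▸ hx₀)) (fun h => hrX (h ▸ hv))
      · rfl
    have h3 : ¬(a e ∈ X ∧ b e ∈ X) := by
      rintro ⟨h3, h4⟩
      exact h (iff_of_false (fun h => hrX (h ▸ h3)) (fun h => hrX (h ▸ h4)))
    have h4 : D e = D₁ e := if_neg h3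
    rw [h4]
    exact h₁.agree e he (by simpa only [Function.comp, hr] using h)
  · by_cases hZX : (Z ∩ X ∩ T).Nonempty
    · have g1 := outDeg_inter_add_union_le E (tailOf a b D) (headOf a b D) Z X
      have g2 : k ≤ outDeg E (tailOf a b D) (headOf a b D) (Z ∩ X) := by
        rw [(d₂ _ inter_subset_right).1]
        refine h₂.le_out _ (fun h => hZ (mem_inter.1 h).1) ?_
        obtain ⟨v, hv⟩ := hZX
        simp only [mem_inter] at hv
        exact ⟨v, by simp [hv]⟩
      have g3 : k ≤ outDeg E (tailOf a b D) (headOf a b D) (Z ∪ X) := by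
        rw [(d₁ _ (Or.inr subset_union_right)).1]
        refine h₁.le_out _ (by simp [hZ, hrX]) ⟨x₀, mem_inter.2 ⟨mem_union_right _ hx₀, ?_⟩⟩
        exact mem_image.2 ⟨x₀, hx₀T, by rw [hπ₁, if_pos hx₀]⟩
      omega
    · have g1 := outDeg_sdiff_add_swap_le E (tailOf a b D) (headOf a b D) Z X
      have hnot : ∀ v, v ∈ Z → v ∈ T → v ∉ X := fun v h1 h2 h3 => hZX ⟨v, by simp [h1, h2, h3]⟩
      have g2 : k ≤ outDeg E (tailOf a b D) (headOf a b D) (Z \ X) := by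
        rw [(d₁ _ (Or.inl sdiff_disjoint)).1]
        refine h₁.le_out _ (fun h => hZ (mem_sdiff.1 h).1) ?_
        obtain ⟨v, hv⟩ := hZT
        obtain ⟨hv1, hv2⟩ := mem_inter.1 hv
        have hv3 := hnot v hv1 hv2
        exact ⟨v, mem_inter.2 ⟨mem_sdiff.2 ⟨hv1, hv3⟩,
          mem_image.2 ⟨v, hv2, by rw [hπ₁, if_neg hv3]⟩⟩⟩
      have g3 : k ≤ outDeg E (headOf a b D) (tailOf a b D) (X \ Z) := by
        rw [(d₂ _ sdiff_subset).2]
        refine h₂.le_in _ (fun h => hrX (mem_sdiff.1 h).1) fun v hv => ?_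
        obtain ⟨hv1, hv2⟩ := mem_inter.1 hv
        exact mem_sdiff.2 ⟨hv2, fun h => hnot v h hv1 hv2⟩
      omega
  · have g1 := outDeg_inter_add_union_le E (headOf a b D) (tailOf a b D) Y X
    have g2 : k ≤ outDeg E (headOf a b D) (tailOf a b D) (Y ∩ X) := by
      rw [(d₂ _ inter_subset_right).2]
      exact h₂.le_in _ (fun h => hY (mem_inter.1 h).1) (inter_subset_inter_right hTY)
    have g3 : k ≤ outDeg E (headOf a b D) (tailOf a b D) (Y ∪ X) := by
      rw [(d₁ _ (Or.inr subset_union_right)).2]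
      refine h₁.le_in _ (by simp [hY, hrX]) fun v hv => ?_
      obtain ⟨w, hw, rfl⟩ := mem_image.1 hv
      rw [e₁ _ (Or.inr subset_union_right)]
      exact mem_union_left _ (hTY hw)
    omega

/-- Every balanced orientation at a root of degree `2 * k` extends to a Steiner rooted
`k`-arc-connected orientation. -/
theorem exists_isExtension [Fintype V] [Fintype β] [DecidableEq β] (hr : r ∉ T) (hT : T.Nonempty)
    (hcut : ∀ Z, r ∉ Z → (Z ∩ T).Nonempty → 2 * k ≤ cutDeg E a b Z)
    (hrcut : cutDeg E a b {r} = 2 * k)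
    (hro : outDeg E (tailOf a b o) (headOf a b o) {r} = k) :
    ∃ D, IsExtension E a b r T k o D := by
  induction hn : #{e ∈ E | a e ∉ insert r T ∧ b e ∉ insert r T} using Nat.strong_induction_on
    generalizing E a b T o with
  | _ n ih =>
  subst hn
  by_cases hSS : ∃ e ∈ E, a e ∉ insert r T ∧ b e ∉ insert r T
  · obtain ⟨e, he, hea, heb⟩ := hSS
    by_cases htight : ∃ X, r ∉ X ∧ (X ∩ T).Nonempty ∧ cutDeg E a b X = 2 * k ∧
        ¬(a e ∈ X ↔ b e ∈ X)
    · obtain ⟨X, hrX, ⟨x₀, hx₀⟩, hX, heX⟩ := htight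
      obtain ⟨hx₀, hx₀T⟩ := mem_inter.1 hx₀
      let π₁ : V → V := fun v => if v ∈ X then x₀ else v
      let π₂ : V → V := fun v => if v ∈ X then v else r
      have hπ₁ : ∀ v, π₁ v = if v ∈ X then x₀ else v := fun _ => rfl
      have hπ₂ : ∀ v, π₂ v = if v ∈ X then v else r := fun _ => rfl
      have hx₀1 : x₀ ∈ T.image π₁ := mem_image.2 ⟨x₀, hx₀T, if_pos hx₀⟩
      have hr₁ : ∀ v, π₁ v = r ↔ v = r := by
        intro v
        rw [hπ₁]
        split_ifs with hv
        · exact iff_of_false (fun h => hrX (h ▸ hx₀)) (fun h => hrX (h ▸ hv))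
        · rfl
      have hr₁' : ∀ v, π₁ v ∈ ({r} : Finset V) ↔ v ∈ ({r} : Finset V) := by simpa using hr₁
      have hrT₁ : r ∉ T.image π₁ := by
        intro h
        obtain ⟨v, hv, hvr⟩ := mem_image.1 h
        exact hr ((hr₁ v).1 hvr ▸ hv)
      have hro₁ : outDeg E (tailOf (π₁ ∘ a) (π₁ ∘ b) o) (headOf (π₁ ∘ a) (π₁ ∘ b) o) {r} = k := by
        rw [tailOf_comp, headOf_comp, outDeg_comp hr₁', hro]
      have hrcut₁ : cutDeg E (π₁ ∘ a) (π₁ ∘ b) {r} = 2 * k := by rw [cutDeg_comp hr₁', hrcut]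
      obtain ⟨D, hD⟩ := ih _ (card_steiner_edges_comp_lt (π := π₁) (T' := T.image π₁)
          (p := fun v => v ∉ X) (fun v hv => by
            refine ⟨fun h => hv ?_, fun h => hv ?_⟩
            · rcases mem_insert.1 h with h | h
              · rw [(hr₁ v).2 h]; exact mem_insert_self _ _
              · exact mem_insert_of_mem (mem_image_of_mem _ h)
            · rw [hπ₁, if_pos h]; exact mem_insert_of_mem hx₀1) he hea heb (by tauto))
        (E := E) (a := π₁ ∘ a) (b := π₁ ∘ b) (T := T.image π₁) (o := o) hrT₁ ⟨x₀, hx₀1⟩ (by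
          intro Z hZ hZT
          rw [cutDeg_comp (Z := {v | π₁ v ∈ Z}) (by simp)]
          refine hcut _ (by simpa [(hr₁ r).2 rfl] using hZ) ?_
          obtain ⟨w, hw⟩ := hZT
          obtain ⟨hw1, hw2⟩ := mem_inter.1 hw
          obtain ⟨v, hv, rfl⟩ := mem_image.1 hw2
          exact ⟨v, by simp [hw1, hv]⟩) hrcut₁ hro₁ rfl
      have hin₁ := outDeg_tailOf_add E (π₁ ∘ a) (π₁ ∘ b) o {r}
      -- Exactly `k` of the `2 * k` edges at the contracted `x₀` leave it, so `D₁` is balanced at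
      -- the root of the other contraction.
      obtain ⟨D₁, hD₁, hout₁⟩ := hD.exists_outDeg_eq hrT₁ (by omega) hx₀1
      have hout : outDeg E (tailOf a b D₁) (headOf a b D₁) X = k := by
        rw [← hout₁, tailOf_comp, headOf_comp]
        refine (outDeg_comp fun v => ?_).symm
        rw [hπ₁, mem_singleton]
        split_ifs with hv
        · exact iff_of_true rfl hv
        · exact iff_of_false (fun h => hv (h ▸ hx₀)) hv
      have hr₂ : ∀ v, π₂ v ∈ ({r} : Finset V) ↔ v ∈ Xᶜ := by
        intro v
        rw [hπ₂, mem_singleton, mem_compl]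
        split_ifs with hv
        · exact iff_of_false (fun h => hrX (h ▸ hv)) (not_not.2 hv)
        · exact iff_of_true rfl hv
      have hcutX : cutDeg E a b Xᶜ = cutDeg E a b X := by
        rw [cutDeg, cutDeg]
        refine congrArg card (filter_congr fun e _ => ?_)
        simp only [mem_compl, not_iff_not]
      obtain ⟨D₂, hD₂⟩ := ih _ (card_steiner_edges_comp_lt (π := π₂) (T' := T ∩ X)
          (p := fun v => v ∈ X) (fun v hv => by
            by_cases hvX : v ∈ X
            · rw [hπ₂, if_pos hvX] at hv
              simp only [mem_insert, mem_inter] at hv ⊢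
              tauto
            · rw [hπ₂, if_neg hvX] at hv
              exact absurd (mem_insert_self _ _) hv) he hea heb (by tauto))
        (E := E) (a := π₂ ∘ a) (b := π₂ ∘ b) (T := T ∩ X) (o := D₁)
        (fun h => hr (mem_inter.1 h).1) ⟨x₀, mem_inter.2 ⟨hx₀T, hx₀⟩⟩ (by
          intro Z hZ hZT
          rw [cutDeg_comp (Z := Z ∩ X) (by
            intro v
            rw [hπ₂, mem_inter]
            split_ifs with hv <;> simp [hv, hZ])]
          refine hcut _ (fun h => hZ (mem_inter.1 h).1) ?_
          obtain ⟨w, hw⟩ := hZT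
          simp only [mem_inter] at hw
          exact ⟨w, by simp [hw]⟩)
        (by rw [cutDeg_comp hr₂, hcutX, hX])
        (by
          rw [tailOf_comp, headOf_comp, outDeg_comp hr₂, outDeg_compl]
          have := outDeg_tailOf_add E a b D₁ X
          omega) rfl
      exact hD₁.combine hrX hx₀ hx₀T hX hπ₁ hπ₂ hout hD₂
    · have hcutE : ∀ Z, cutDeg (E.erase e) a b Z + (if ¬(a e ∈ Z ↔ b e ∈ Z) then 1 else 0) =
          cutDeg E a b Z := by
        intro Z
        simp only [cutDeg, card_filter]
        exact sum_erase_add _ _ he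
      have hra : a e ≠ r := fun h => hea (h ▸ mem_insert_self _ _)
      have hrb : b e ≠ r := fun h => heb (h ▸ mem_insert_self _ _)
      have hlt : #{f ∈ E.erase e | a f ∉ insert r T ∧ b f ∉ insert r T} <
          #{f ∈ E | a f ∉ insert r T ∧ b f ∉ insert r T} := by
        refine card_lt_card ⟨filter_subset_filter _ (erase_subset _ _), fun h => ?_⟩
        exact notMem_erase e E (mem_filter.1 (h (mem_filter.2 ⟨he, hea, heb⟩))).1
      obtain ⟨D, hD⟩ := ih _ hlt (E := E.erase e) (a := a) (b := b) (T := T) (o := o) hr hT (by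
          intro Z hZ hZT
          have h1 := hcut Z hZ hZT
          have h2 := hcutE Z
          split_ifs at h2 with h3
          · omega
          · have h4 : cutDeg E a b Z ≠ 2 * k := fun h => htight ⟨Z, hZ, hZT, h, h3⟩
            omega)
        (by
          have := hcutE {r}
          simpa [hra, hrb, hrcut] using this)
        (by
          rw [← hro]
          simp only [outDeg, card_filter]
          refine sum_subset (erase_subset _ _) fun f hf hf' => ?_
          have : f = e := by
            by_contra h
            exact hf' (mem_erase.2 ⟨h, hf⟩)
          subst this
          simp only [tailOf, headOf]
          obtain h | h : o f = true ∨ o f = false := by cases o f <;> simp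
          all_goals simp [h, hra, hrb]) rfl
      refine ⟨D, fun f hf hfr => ?_, fun Z hZ hZT => ?_, fun Y hY hTY => ?_⟩
      · refine hD.agree f (mem_erase.2 ⟨?_, hf⟩) hfr
        rintro rfl
        exact hfr (iff_of_false hra hrb)
      · exact (hD.le_out Z hZ hZT).trans (outDeg_mono (erase_subset _ _) _ _ _)
      · exact (hD.le_in Y hY hTY).trans (outDeg_mono (erase_subset _ _) _ _ _)
  · push Not at hSS
    -- Loops at `r` are dropped; they cross no cut.
    have hcutE : ∀ Z, cutDeg {e ∈ E | ¬(a e = r ∧ b e = r)} a b Z = cutDeg E a b Z := by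
      intro Z
      rw [cutDeg, cutDeg, filter_filter]
      refine congrArg card (filter_congr fun e _ => ?_)
      constructor
      · exact fun h => h.2
      · exact fun h => ⟨fun h' => h (by rw [h'.1, h'.2]), h⟩
    obtain ⟨D, h1, h2, h3⟩ := exists_extension_of_no_steiner_edge
      (E := {e ∈ E | ¬(a e = r ∧ b e = r)}) (a := a) (b := b) (k := k) (o := o) hr hT
      (fun e he => by
        have := hSS e (mem_filter.1 he).1
        tauto)
      (fun e he => (mem_filter.1 he).2)
      (fun Z hZ hZT => by rw [hcutE]; exact hcut Z hZ hZT) (by rw [hcutE, hrcut]) (by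
        rw [← hro, outDeg, outDeg, filter_filter]
        refine congrArg card (filter_congr fun e _ => ?_)
        refine ⟨fun h => h.2, fun h => ⟨fun h' => ?_, h⟩⟩
        simp [tailOf, headOf, h'.1, h'.2] at h)
    refine ⟨D, fun e he h => ?_, fun Z hZ hZT => ?_, fun Y hY hTY => ?_⟩
    · exact h1 e (mem_filter.2 ⟨he, fun h' => h (iff_of_true h'.1 h'.2)⟩) h
    · exact (h2 Z hZ hZT).trans (outDeg_mono (filter_subset _ _) _ _ _)
    · exact (h3 Y hY hTY).trans (outDeg_mono (filter_subset _ _) _ _ _)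

end Extension

/-! ### Roots of arbitrary degree, and the transfer to `Graph` -/

theorem IsDipath.exists_vert {V β : Type*} [DecidableEq V] {s t : β → V} {r x : V} {p : List β}
    (h : IsDipath s t r x p) : ∃ vert : Fin (p.length + 1) → V, vert 0 = x ∧
      vert (Fin.last p.length) = r ∧
      (∀ i : Fin p.length, s (p.get i) = vert i.castSucc ∧ t (p.get i) = vert i.succ) ∧
      Function.Injective vert ∧ ∀ i, vert i ∈ p.map s ∨ vert i = r := by
  induction h with
  | nil =>
    exact ⟨fun _ => r, rfl, rfl, fun i => i.elim0, Function.injective_of_subsingleton (α := Fin 1) _,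
      fun _ => Or.inr rfl⟩
  | cons e p h h1 h2 ih =>
    obtain ⟨vert, v1, v2, v3, v4, v5⟩ := ih
    refine ⟨Fin.cons (s e) vert, rfl, ?_, fun i => ?_, ?_, fun i => ?_⟩
    · exact v2
    · refine Fin.cases ⟨rfl, ?_⟩ (fun j => ?_) i
      · exact v1.symm
      · exact v3 j
    · refine Fin.cons_injective_iff.2 ⟨?_, v4⟩
      rintro ⟨i, hi⟩
      rcases v5 i with h3 | h3
      · exact h2 (hi ▸ h3)
      · exact h1 (hi ▸ h3)
    · refine Fin.cases (Or.inl (by simp)) (fun j => ?_) i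
      rcases v5 j with h3 | h3
      · exact Or.inl (List.mem_cons_of_mem _ h3)
      · exact Or.inr h3

/-- A multigraph with a root `r` that is not necessarily of degree `2 * k`. -/
theorem exists_orientation_of_le_cutDeg {V β : Type*} [DecidableEq V] [Fintype V] [Fintype β]
    [DecidableEq β] {a b : β → V} {r : V} {T : Finset V} {k : ℕ}
    (hcut : ∀ Z, r ∉ Z → (Z ∩ T).Nonempty → 2 * k ≤ cutDeg univ a b Z) :
    ∃ D : β → Bool, ∀ Z, r ∉ Z → (Z ∩ T).Nonempty →
      k ≤ outDeg univ (tailOf a b D) (headOf a b D) Z := by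
  -- The new root is `none`; the first `k` of its edges enter it and the others leave it. The old
  -- root becomes a terminal, which costs nothing: a set that contains it and avoids `none` is
  -- crossed by all new edges.
  let a' : β ⊕ Fin (2 * k) → Option V := Sum.elim (fun e => some (a e)) (fun _ => some r)
  let b' : β ⊕ Fin (2 * k) → Option V := Sum.elim (fun e => some (b e)) (fun _ => none)
  let o : β ⊕ Fin (2 * k) → Bool := Sum.elim (fun _ => true) (fun i => decide (i.1 < k))
  let T' : Finset (Option V) := (insert r T).image some
  obtain ⟨D, hD⟩ := exists_isExtension (E := univ) (a := a') (b := b') (r := none) (T := T')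
    (k := k) (o := o) (by simp [T']) ⟨some r, by simp [T']⟩ (by
      intro Z hZ hZT
      rw [cutDeg, card_filter, Fintype.sum_sum_type]
      simp only [a', b', Sum.elim_inl, Sum.elim_inr]
      by_cases hr : some r ∈ Z
      · simp [hr, hZ]
      · refine le_trans ?_ (Nat.le_add_right _ _)
        have h1 := hcut {v | some v ∈ Z} (by simpa using hr) (by
          obtain ⟨w, hw⟩ := hZT
          obtain ⟨hw1, hw2⟩ := mem_inter.1 hw
          obtain ⟨v, hv, rfl⟩ := mem_image.1 hw2
          have : v ≠ r := fun h => hr (h ▸ hw1)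
          exact ⟨v, by simpa [hw1, this] using hv⟩)
        rw [cutDeg, card_filter] at h1
        refine h1.trans (le_of_eq (sum_congr rfl fun e _ => ?_))
        exact if_congr (by simp) rfl rfl)
    (by
      rw [cutDeg, card_filter, Fintype.sum_sum_type]
      simp [a', b'])
    (by
      rw [outDeg, card_filter, Fintype.sum_sum_type]
      have h1 : ∀ e : β, ¬(tailOf a' b' o (Sum.inl e) ∈ ({none} : Finset (Option V)) ∧
          headOf a' b' o (Sum.inl e) ∉ ({none} : Finset (Option V))) := by
        intro e; simp [a', tailOf, o]
      have h2 : ∀ i : Fin (2 * k), (tailOf a' b' o (Sum.inr i) ∈ ({none} : Finset (Option V)) ∧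
          headOf a' b' o (Sum.inr i) ∉ ({none} : Finset (Option V))) ↔ ¬i.1 < k := by
        intro i
        by_cases h : i.1 < k <;> simp [a', b', tailOf, headOf, o, h]
      simp only [h1, h2, if_false, sum_const_zero, zero_add]
      rw [Fin.sum_univ_eq_sum_range (fun i => if ¬i < k then 1 else 0), two_mul,
        sum_range_add]
      have h3 : ∑ x ∈ range k, (if ¬x < k then 1 else 0) = 0 :=
        sum_eq_zero fun x hx => by simpa using hx
      rw [h3]
      simp)
  refine ⟨fun e => D (Sum.inl e), fun Z hZ hZT => ?_⟩
  have h1 := hD.le_out (Z.image some) (by simp) (by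
    obtain ⟨v, hv⟩ := hZT
    obtain ⟨hv1, hv2⟩ := mem_inter.1 hv
    exact ⟨some v, by simp [T', hv1, hv2]⟩)
  rw [outDeg, card_filter, Fintype.sum_sum_type] at h1
  have h2 : ∀ i : Fin (2 * k), ¬(tailOf a' b' D (Sum.inr i) ∈ Z.image some ∧
      headOf a' b' D (Sum.inr i) ∉ Z.image some) := by
    intro i
    rintro ⟨h, -⟩
    cases h3 : D (Sum.inr i) <;> simp [tailOf, a', b', h3, hZ] at h
  simp only [h2, if_false, sum_const_zero, add_zero] at h1
  rw [outDeg, card_filter]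
  refine h1.trans (sum_le_sum fun e _ => ?_)
  cases h3 : D (Sum.inl e) <;> simp [tailOf, headOf, a', b', h3]

end SteinerOrientation

open SteinerOrientation in
/-- Steiner rooted orientation of graphs. `G` is a finite undirected multigraph. -/
theorem mainTheorem6 {α : Type*} {β : Type*} (G : Graph α β)
    (hV : V(G).Finite) (hE : E(G).Finite)
    (T : Set α) (hT : T ⊆ V(G)) (r : α) (hr : r ∈ T)
    (k : ℕ) (hk : 0 < k)
    (hG : G.IsSteinerEdgeConnected T (2 * k)) :
    ∃ D : G.Orientation, D.IsSteinerRootedConnected T r k := by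
  classical
  have : Fintype V(G) := hV.fintype
  have : Fintype E(G) := hE.fintype
  have hends : ∀ e : E(G), ∃ p : V(G) × V(G), G.IsLink e p.1 p.2 := by
    rintro ⟨e, he⟩
    obtain ⟨x, y, hxy⟩ := G.exists_isLink_of_mem_edgeSet he
    exact ⟨(⟨x, hxy.left_mem⟩, ⟨y, hxy.right_mem⟩), hxy⟩
  choose p hp using hends
  let r' : V(G) := ⟨r, hT hr⟩
  let T' : Finset V(G) := {v | v.1 ∈ T}
  obtain ⟨D, hD⟩ := exists_orientation_of_le_cutDeg (a := fun e => (p e).1) (b := fun e => (p e).2)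
    (r := r') (T := T') (k := k) (by
      intro Z hZ hZT
      obtain ⟨v, hv⟩ := hZT
      obtain ⟨hvZ, hvT⟩ := Finset.mem_inter.1 hv
      have hvT : v.1 ∈ T := by simpa [T'] using hvT
      have hvr : v.1 ≠ r := fun h => hZ ((Subtype.ext h : v = r') ▸ hvZ)
      -- The set `X` separates the terminal `v` from `r`, so its cut value is bounded below by their
      -- local connectivity.
      let X : Set α := Subtype.val '' (Z : Set V(G))
      have hX : ∀ w : V(G), w.1 ∈ X ↔ w ∈ Z := by
        intro w
        simp [X]
      have h1 : ((2 * k : ℕ) : ℕ∞) ≤ G.cutValue X := by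
        refine (hG v.1 hvT r hr hvr).trans (iInf₂_le X ⟨(hX v).2 hvZ, ?_⟩)
        rintro _ ⟨w, hw, rfl⟩
        exact ⟨w.2, fun h => hZ ((Subtype.ext h : w = r') ▸ hw)⟩
      have h2 : G.cutValue X ≤ ((cutDeg Finset.univ (fun e => (p e).1) (fun e => (p e).2) Z : ℕ) : ℕ∞) := by
        rw [Graph.cutValue, cutDeg, ← Set.encard_coe_eq_coe_finsetCard,
          ← Subtype.val_injective.encard_image]
        refine Set.encard_le_encard ?_
        rintro e ⟨x, hx, y, hy, hxy⟩
        refine ⟨⟨e, hxy.edge_mem⟩, ?_, rfl⟩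
        simp only [Finset.coe_filter, Finset.mem_univ, true_and, Set.mem_ofPred_eq]
        rw [← hX, ← hX]
        rcases hxy.eq_and_eq_or_eq_and_eq (hp ⟨e, hxy.edge_mem⟩) with ⟨h3, h4⟩ | ⟨h3, h4⟩
        · rw [← h3, ← h4]; tauto
        · rw [← h3, ← h4]; tauto
      exact_mod_cast h1.trans h2)
  have hlink : ∀ e : E(G), G.IsLink e (tailOf (fun e => (p e).1) (fun e => (p e).2) D e : V(G)).1
      (headOf (fun e => (p e).1) (fun e => (p e).2) D e : V(G)).1 := by
    intro e
    rw [tailOf, headOf]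
    cases D e
    · exact (hp e).symm
    · exact hp e
  refine ⟨⟨fun e => Subtype.val (tailOf (fun e => (p e).1) (fun e => (p e).2) D e),
    fun e => Subtype.val (headOf (fun e => (p e).1) (fun e => (p e).2) D e), hlink⟩, fun t ht => ?_⟩
  have htr : (⟨t, hT ht.1⟩ : V(G)) ≠ r' := fun h => ht.2 (congrArg Subtype.val h)
  obtain ⟨P, hP, hdisj⟩ := exists_arcDisjoint_dipaths htr (k := k) (fun Z h1 h2 =>
    hD Z h2 ⟨_, Finset.mem_inter.2 ⟨h1, by simpa [T'] using ht.1⟩⟩)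
  choose vert v1 v2 v3 v4 v5 using fun i => (hP i).2.exists_vert
  refine ⟨fun i => ⟨(P i).length, fun j => vert i j, (P i).get, ?_, ?_, fun j => ?_, fun j => ?_,
    fun j j' h => v4 i (Subtype.ext h)⟩, fun i j hij => ?_⟩
  · rw [v1]
  · rw [v2]
  · rw [← (v3 i j).1]
  · rw [← (v3 i j).2]
  · refine Set.disjoint_left.2 ?_
    rintro e ⟨m, hm⟩ ⟨n, hn⟩
    have h1 : (P i).get m = e := hm
    have h2 : (P j).get n = e := hn
    exact hdisj hij (h1 ▸ List.get_mem (P i) m) (h2 ▸ List.get_mem (P j) n)
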